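/- Let $k\ge 2$ be an integer. For an integer $N\ge 1$ put $n=N^k$ and let $X\in\{0,1\}^{N\times\cdots\times N}$ be a $k$-th order binary tensor of side $N=n^{1/k}$ whose $n$ entries are independent and uniform on $\{0,1\}$. A trace of $X$ with deletion probability $p$ is obtained by deleting, independently for each of the $k$ dimensions and each of the $N$ indices along that dimension, the corresponding slice of $X$ with probability $p$, and renumbering the surviving indices in increasing order along each dimension. For a function $m=m(N)$, a reconstruction procedure with $m$ traces is, for each $N$, a function of $m(N)$ traces (it may depend on $N,k,p$) whose output is a tensor in $\{0,1\}^{N\times\cdots\times N}$; it succeeds with high probability if, when it is given $m(N)$ traces of $X$ produced by independent uses of the channel, the probability, over both $X$ and the channel, that its output equals $X$ tends to $1$ as $N\to\infty$ with $k$ and $p$ fixed. 1. (Upper bound.) There is an absolute constant $C>0$ such that for every $k\ge 2$, every fixed $p\in[0,1)$ and every $m$ with $m(N)\ge C\,\dfrac{\log n}{(1-p)^k}$ for all sufficiently large $N$, there is a reconstruction procedure with $m$ traces that succeeds with high probability. 2. (Tightness.) For every $p_0>0$ there is a constant $c>0$, depending only on $p_0$, such that for every $k\ge 2$ and every fixed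 $p\in[p_0,1)$, if some reconstruction procedure with $m$ traces succeeds with high probability, then $m(N)\ge c\,\dfrac{\log n}{(1-p)^k}$ for all sufficiently large $N$. -/

import Mathlib

open Filter Topology

noncomputable section

namespace TensorReconstruction

/-- Binary tensors of order `k` with side length `N` (so with `n = N ^ k` entries). -/
abbrev BinTensor (k N : ℕ) : Type := (Fin k → Fin N) → Bool

/-- A trace: a binary tensor of order `k` with its own list of side lengths. -/
abbrev Trace (k : ℕ) : Type := (d : Fin k → ℕ) × (((r : Fin k) → Fin (d r)) → Bool)

/-- A retention pattern: along every dimension, the set of indices that are not deleted. -/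
abbrev Pattern (k N : ℕ) : Type := Fin k → Finset (Fin N)

/-- The tensor that remains when, along every dimension `r`, all indices outside `S r` are deleted
and the surviving indices are renumbered in increasing order. -/
def traceOf {k N : ℕ} (X : BinTensor k N) (S : Pattern k N) : Trace k :=
  ⟨fun r => (S r).card, fun i => X fun r => (S r).orderEmbOfFin rfl (i r)⟩

/-- The probability of the pattern `S` in the tensor deletion channel: each of the `N` indices
along each of the `k` dimensions is deleted independently with probability `p`. -/
def patternProb {k N : ℕ} (p : ℝ) (S : Pattern k N) : ℝ :=
  ∏ r : Fin k, ∏ i : Fin N, if i ∈ S r then 1 - p else p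

/-- A reconstruction procedure from `m` traces for tensors of order `k` and side length `N`. -/
abbrev Estimator (k N m : ℕ) : Type := (Fin m → Trace k) → BinTensor k N

open Classical in
/-- The probability that `est` outputs `X`, when `X` is a uniformly random binary tensor of order `k`
and side length `N` and `est` is given `m` traces of `X`, produced by independent uses of the tensor
deletion channel with deletion probability `p`. -/
def successProb {k N m : ℕ} (p : ℝ) (est : Estimator k N m) : ℝ :=
  ∑ X : BinTensor k N, ∑ S : Fin m → Pattern k N,
    (1 / (Fintype.card (BinTensor k N) : ℝ)) * (∏ t : Fin m, patternProb p (S t)) *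
      (if est (fun t => traceOf X (S t)) = X then 1 else 0)

/-- The sequence of estimators reconstructs a random tensor with high probability: the success
probability tends to `1` as the side length `N` (equivalently `n = N ^ k`) grows. -/
def ReconstructsWHP {k : ℕ} (p : ℝ) (m : ℕ → ℕ) (est : (N : ℕ) → Estimator k N (m N)) : Prop :=
  Tendsto (fun N => successProb p (est N)) atTop (𝓝 1)

end TensorReconstruction

end

namespace TensorReconstruction

open Finset

/-! ### The law of the retention patterns -/

/-! Write q = 1 - p, and call a pair of a dimension and an index a cell.

Upper bound. With 2 log n / q^k traces, a union bound shows that any k cells survive together in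
some trace, and a Chernoff bound that any two traces share at least l ≈ q²N/4 indices along every
dimension. The estimator explains the traces by a tensor and patterns with these two properties, of
maximal total overlap. Comparing these patterns with the true ones gives, for each pair of traces, a
matching of indices with which X is compatible. Wrong pairs combine with at least l pairs along
another dimension (here k ≥ 2 enters), so F wrong pairs force at least Fl/(2k) equations X u = X v.
Restricted to one dimension and one direction these are triangular, hence independent. A union bound
over matchings shows that X is unlikely to be compatible with a matching, other than the true one,
that has at least as many wrong pairs as it misses true ones (`card_exists_badMatching`). Otherwise
each matching is true or strictly smaller than the true one, and maximality makes all of them true.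
The reindexings of the traces then glue to strictly increasing self-maps of `Fin N`, which are
identities, and X is recovered (`eq_of_totalOverlap_le`).

Lower bound. Flipping an entry that no trace observes leaves all traces unchanged, so an estimator
is then right with probability at most 1/2. Below the threshold the second moment method shows that
such an entry exists with probability at least 1/2: entries agreeing in s coordinates are correlated
by a factor of at most N^(s/2) (`unseen_pair_le`), and most pairs of entries agree in few
coordinates. The success probability then stays below 3/4. -/

theorem sum_pattern_prod {k N : ℕ} (a b : Fin k → Fin N → ℝ) :
    ∑ P : Pattern k N, ∏ r, ∏ i, (if i ∈ P r then a r i else b r i) =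
      ∏ r, ∏ i, (a r i + b r i) := by
  have h : ∀ r, ∏ i, (a r i + b r i) =
      ∑ s : Finset (Fin N), ∏ i, (if i ∈ s then a r i else b r i) := by
    intro r
    rw [Finset.prod_add, Finset.powerset_univ]
    refine Finset.sum_congr rfl fun s _ => ?_
    rw [Finset.prod_ite]
    congr 1
    · congr 1; ext; simp
    · congr 1; ext; simp
  simp_rw [h]
  rw [Finset.prod_univ_sum, Fintype.piFinset_univ]

theorem patternProb_nonneg {k N : ℕ} {p : ℝ} (h0 : 0 ≤ p) (h1 : p ≤ 1) (S : Pattern k N) :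
    0 ≤ patternProb p S :=
  Finset.prod_nonneg fun r _ => Finset.prod_nonneg fun i _ => by split_ifs <;> linarith

theorem sum_patternProb {k N : ℕ} (p : ℝ) : ∑ S : Pattern k N, patternProb p S = 1 := by
  unfold patternProb
  rw [sum_pattern_prod (fun _ _ => 1 - p) (fun _ _ => p)]
  simp

/-- The probability that a pattern retains all the cells of `B`. -/
theorem sum_patternProb_retain {k N : ℕ} (p : ℝ) (B : Finset (Fin k × Fin N)) :
    ∑ S : Pattern k N, patternProb p S * (if ∀ c ∈ B, c.2 ∈ S c.1 then 1 else 0) =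
      (1 - p) ^ B.card := by
  have h : ∀ S : Pattern k N,
      patternProb p S * (if ∀ c ∈ B, c.2 ∈ S c.1 then (1 : ℝ) else 0) =
        ∏ r, ∏ i, (if i ∈ S r then 1 - p else if (r, i) ∈ B then 0 else p) := by
    intro S
    split_ifs with hB
    · rw [mul_one]
      refine Finset.prod_congr rfl fun r _ => Finset.prod_congr rfl fun i _ => ?_
      split_ifs with h1 h2
      · rfl
      · exact absurd (hB _ h2) h1
      · rfl
    · push Not at hB
      obtain ⟨c, hc, hcS⟩ := hB
      rw [mul_zero, eq_comm]
      refine Finset.prod_eq_zero (Finset.mem_univ c.1) (Finset.prod_eq_zero (Finset.mem_univ c.2) ?_)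
      rw [if_neg hcS, if_pos hc]
  simp_rw [h]
  rw [sum_pattern_prod (fun _ _ => 1 - p) (fun r i => if (r, i) ∈ B then 0 else p)]
  rw [← Fintype.prod_prod_type'
    (fun (r : Fin k) (i : Fin N) => 1 - p + if (r, i) ∈ B then (0 : ℝ) else p)]
  rw [← Finset.prod_const, ← Finset.prod_subset (Finset.subset_univ B)]
  · exact Finset.prod_congr rfl fun c hc => by simp [hc]
  · intro c _ hc
    simp [hc]

/-- The weight of a family of independent patterns. -/
def familyProb {k N m : ℕ} (p : ℝ) (S : Fin m → Pattern k N) : ℝ := ∏ t, patternProb p (S t)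

theorem familyProb_nonneg {k N m : ℕ} {p : ℝ} (h0 : 0 ≤ p) (h1 : p ≤ 1)
    (S : Fin m → Pattern k N) : 0 ≤ familyProb p S :=
  Finset.prod_nonneg fun _ _ => patternProb_nonneg h0 h1 _

/-- Independence of the traces. -/
theorem sum_familyProb_mul_prod {k N m : ℕ} (p : ℝ) (h : Fin m → Pattern k N → ℝ) :
    ∑ S : Fin m → Pattern k N, familyProb p S * ∏ t, h t (S t) =
      ∏ t, ∑ P : Pattern k N, patternProb p P * h t P := by
  rw [Finset.prod_univ_sum, Fintype.piFinset_univ]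
  exact Finset.sum_congr rfl fun S _ => by rw [familyProb, Finset.prod_mul_distrib]

theorem sum_familyProb {k N m : ℕ} (p : ℝ) :
    ∑ S : Fin m → Pattern k N, familyProb p S = 1 := by
  have := sum_familyProb_mul_prod (k := k) (N := N) (m := m) p (fun _ _ => 1)
  simpa [sum_patternProb] using this

/-- The joint law of two distinct traces. -/
theorem sum_familyProb_pair {k N m : ℕ} (p : ℝ) {t s : Fin m} (hts : t ≠ s)
    (g : Pattern k N → Pattern k N → ℝ) :
    ∑ S : Fin m → Pattern k N, familyProb p S * g (S t) (S s) =
      ∑ P, ∑ Q, patternProb p P * patternProb p Q * g P Q := by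
  -- Expanding `g` in indicators of the values of both patterns turns it into a combination of
  -- products over the traces, to which independence applies.
  have h1 : ∀ S : Fin m → Pattern k N, g (S t) (S s) =
      ∑ P, ∑ Q, (∏ j, if j = t then (if S j = P then 1 else 0) else
        if j = s then (if S j = Q then 1 else 0) else (1 : ℝ)) * g P Q := by
    intro S
    have h2 : ∀ P Q, (∏ j, if j = t then (if S j = P then 1 else 0) else
        if j = s then (if S j = Q then 1 else 0) else (1 : ℝ)) =
        (if S t = P then 1 else 0) * (if S s = Q then 1 else 0) := by
      intro P Q
      rw [Fintype.prod_eq_mul t s hts]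
      · simp [hts.symm]
      · rintro x ⟨hx, hx'⟩
        simp [hx, hx']
    simp_rw [h2]
    simp
  simp_rw [h1, Finset.mul_sum]
  rw [Finset.sum_comm]
  refine Finset.sum_congr rfl fun P _ => ?_
  rw [Finset.sum_comm]
  refine Finset.sum_congr rfl fun Q _ => ?_
  simp_rw [← mul_assoc]
  rw [← Finset.sum_mul]
  congr 1
  rw [sum_familyProb_mul_prod p (fun j R => if j = t then (if R = P then 1 else 0) else
        if j = s then (if R = Q then 1 else 0) else (1 : ℝ))]
  rw [Fintype.prod_eq_mul t s hts]
  · simp [hts.symm]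
  · rintro x ⟨hx, hx'⟩
    simp [hx, hx', sum_patternProb]

/-- The probability that no trace in `J` retains all the cells of `B`. -/
theorem sum_familyProb_miss {k N m : ℕ} (p : ℝ) (J : Finset (Fin m))
    (B : Finset (Fin k × Fin N)) :
    ∑ S : Fin m → Pattern k N,
      familyProb p S * (if ∀ t ∈ J, ¬ ∀ c ∈ B, c.2 ∈ S t c.1 then 1 else 0) =
      (1 - (1 - p) ^ B.card) ^ J.card := by
  have h1 : ∀ S : Fin m → Pattern k N,
      (if ∀ t ∈ J, ¬ ∀ c ∈ B, c.2 ∈ S t c.1 then (1 : ℝ) else 0) =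
      ∏ t, (if t ∈ J then 1 - (if ∀ c ∈ B, c.2 ∈ S t c.1 then 1 else 0) else 1) := by
    intro S
    split_ifs with h
    · symm
      refine Finset.prod_eq_one fun t _ => ?_
      split_ifs with ht hB
      · exact absurd hB (h t ht)
      · simp
      · rfl
    · push Not at h
      obtain ⟨t, ht, hB⟩ := h
      symm
      refine Finset.prod_eq_zero (Finset.mem_univ t) ?_
      rw [if_pos ht, if_pos hB, sub_self]
  simp_rw [h1]
  rw [sum_familyProb_mul_prod p (fun t P => if t ∈ J then
    1 - (if ∀ c ∈ B, c.2 ∈ P c.1 then 1 else 0) else (1 : ℝ))]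
  have h2 : ∀ t : Fin m, ∑ P : Pattern k N, patternProb p P * (if t ∈ J then
      1 - (if ∀ c ∈ B, c.2 ∈ P c.1 then 1 else 0) else (1 : ℝ)) =
      if t ∈ J then 1 - (1 - p) ^ B.card else 1 := by
    intro t
    split_ifs with ht
    · simp_rw [mul_sub, Finset.sum_sub_distrib, mul_one]
      rw [sum_patternProb, sum_patternProb_retain]
    · simp [sum_patternProb]
  simp_rw [h2]
  rw [Finset.prod_ite_mem, Finset.univ_inter, Finset.prod_const]

/-- Exponential moment of the number of retained indices of `A` along dimension `r`. -/
theorem sum_patternProb_pow {k N : ℕ} (p x : ℝ) (r : Fin k) (A : Finset (Fin N)) :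
    ∑ P : Pattern k N, patternProb p P * x ^ (P r ∩ A).card =
      (1 - (1 - p) * (1 - x)) ^ A.card := by
  have h : ∀ P : Pattern k N, patternProb p P * x ^ (P r ∩ A).card =
      ∏ r', ∏ i, (if i ∈ P r' then (1 - p) * (if r' = r ∧ i ∈ A then x else 1) else p) := by
    intro P
    have h3 : x ^ (P r ∩ A).card =
        ∏ r', ∏ i, (if i ∈ P r' then (if r' = r ∧ i ∈ A then x else 1) else 1) := by
      rw [Fintype.prod_eq_single r]
      · rw [Finset.prod_ite_mem, Finset.univ_inter, ← Finset.prod_const]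
        simp only [true_and]
        rw [Finset.prod_ite_mem]
      · intro r' hr'
        simp [hr']
    rw [h3, patternProb, ← Finset.prod_mul_distrib]
    refine Finset.prod_congr rfl fun r' _ => ?_
    rw [← Finset.prod_mul_distrib]
    exact Finset.prod_congr rfl fun i _ => by split_ifs <;> simp
  simp_rw [h]
  rw [sum_pattern_prod (fun r' i => (1 - p) * (if r' = r ∧ i ∈ A then x else 1)) (fun _ _ => p)]
  rw [Fintype.prod_eq_single r]
  · rw [← Finset.prod_const, ← Finset.prod_subset (Finset.subset_univ A)]
    · refine Finset.prod_congr rfl fun i hi => ?_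
      simp [hi]; ring
    · intro i _ hi
      simp [hi]
  · intro r' hr'
    simp [hr']

/-- Two traces share few indices along dimension `r` with exponentially small probability. -/
theorem sum_familyProb_overlap {k N m : ℕ} {p : ℝ} (h0 : 0 ≤ p) (h1 : p ≤ 1) {t s : Fin m}
    (hts : t ≠ s) (r : Fin k) (l : ℕ) :
    ∑ S : Fin m → Pattern k N, familyProb p S * (if (S t r ∩ S s r).card < l then 1 else 0) ≤
      2 ^ l * (1 - (1 - p) ^ 2 / 2) ^ N := by
  calc
    -- Chernoff bound: the indicator is dominated by the exponential moment with base 1/2.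
    _ ≤ ∑ S : Fin m → Pattern k N, familyProb p S * (2 ^ l * (1 / 2) ^ (S t r ∩ S s r).card) := by
      refine Finset.sum_le_sum fun S _ => mul_le_mul_of_nonneg_left ?_ (familyProb_nonneg h0 h1 S)
      split_ifs with h
      · rw [one_div, inv_pow, ← div_eq_mul_inv, one_le_div (by positivity)]
        exact pow_le_pow_right₀ (by norm_num) h.le
      · positivity
    _ = ∑ P : Pattern k N, ∑ Q : Pattern k N,
          patternProb p P * patternProb p Q * (2 ^ l * (1 / 2) ^ (P r ∩ Q r).card) :=
      sum_familyProb_pair p hts fun P Q => 2 ^ l * (1 / 2) ^ (P r ∩ Q r).card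
    _ = 2 ^ l * ∑ Q : Pattern k N, patternProb p Q *
          ∑ P : Pattern k N, patternProb p P * (1 / 2) ^ (P r ∩ Q r).card := by
      rw [Finset.sum_comm, Finset.mul_sum]
      refine Finset.sum_congr rfl fun Q _ => ?_
      rw [Finset.mul_sum, Finset.mul_sum]
      exact Finset.sum_congr rfl fun P _ => by ring
    _ = 2 ^ l * (1 - (1 - p) ^ 2 / 2) ^ N := by
      simp_rw [sum_patternProb_pow]
      congr 1
      -- Averaging over `P` has left a power with exponent the size of `Q r`; averaging over `Q` is
      -- a second moment computation of the same kind.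
      have h2 := sum_patternProb_pow (k := k) p (1 - (1 - p) * (1 - 1 / 2)) r
        (Finset.univ : Finset (Fin N))
      simp only [Finset.inter_univ, Finset.card_univ, Fintype.card_fin] at h2
      rw [h2]
      congr 1
      ring

end TensorReconstruction

namespace TensorReconstruction

open Finset

/-! ### Counting tensors compatible with a matching of indices -/

/-- Constraints `X a = X (g a)` along which `h` decreases are independent. -/
theorem card_filter_eq_comp_mul_two_pow_le {α β : Type*} [Fintype α] [DecidableEq α]
    [Preorder β] [WellFoundedLT β] (D : Finset α) (g : α → α) (h : α → β)
    (hg : ∀ a ∈ D, h (g a) < h a) :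
    (univ.filter fun X : α → Bool => ∀ a ∈ D, X a = X (g a)).card * 2 ^ D.card ≤
      2 ^ Fintype.card α := by
  have h1 : (univ.filter fun X : α → Bool => ∀ a ∈ D, X a = X (g a)).card ≤
      Fintype.card ((Dᶜ : Finset α) → Bool) := by
    rw [← Finset.card_univ]
    refine Finset.card_le_card_of_injOn (fun X a => X a) (fun _ _ => by simp) ?_
    intro X hX Y hY hXY
    simp only [coe_filter, mem_univ, true_and, Set.mem_ofPred_eq] at hX hY
    -- The values off `D` determine the tensor: on `D`, each value is copied from a place where `h`
    -- is smaller.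
    have key : ∀ b : β, ∀ a, h a = b → X a = Y a := by
      intro b
      induction b using WellFoundedLT.induction with
      | ind b ih =>
        rintro a rfl
        by_cases ha : a ∈ D
        · rw [hX a ha, hY a ha]
          exact ih _ (hg a ha) _ rfl
        · exact congrFun hXY ⟨a, by simpa using ha⟩
    exact funext fun a => key _ a rfl
  calc _ ≤ Fintype.card ((Dᶜ : Finset α) → Bool) * 2 ^ D.card := Nat.mul_le_mul_right _ h1
    _ = 2 ^ Fintype.card α := by
      rw [Fintype.card_fun, Fintype.card_coe, Fintype.card_bool, ← pow_add, Finset.card_compl,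
        Nat.sub_add_cancel (Finset.card_le_univ D)]

/-- A family of relations between indices, one for each dimension: `(r, a, b)` relates the index
`a` to the index `b` along dimension `r`. -/
abbrev Matching (k N : ℕ) : Type := Finset (Fin k × Fin N × Fin N)

/-- The tensor takes equal values at entries that are matched along all dimensions. -/
def Compatible {k N : ℕ} (X : BinTensor k N) (M : Matching k N) : Prop :=
  ∀ u v : Fin k → Fin N, (∀ r, (r, u r, v r) ∈ M) → X u = X v

/-- Every index is matched to at most one index. -/
def RightUnique {k N : ℕ} (M : Matching k N) : Prop :=
  ∀ r a b b', (r, a, b) ∈ M → (r, a, b') ∈ M → b = b'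

/-- The pairs of `M` along dimension `r`. -/
def fiber {k N : ℕ} (M : Matching k N) (r : Fin k) : Matching k N := M.filter fun x => x.1 = r

open Classical in
-- Right uniqueness makes the pairs in `G` a partial function along each dimension, so every entry
-- of the product of their domains carries one equation. Strict decrease along the single dimension
-- `r` makes the whole system triangular.
theorem card_compatible_mul_le {k N : ℕ} {M : Matching k N} (hM : RightUnique M)
    (G : Fin k → Matching k N) (hGM : ∀ r, G r ⊆ fiber M r)
    {β : Type*} [Preorder β] [WellFoundedLT β] (h : Fin N → β) (r : Fin k)
    (hr : ∀ x ∈ G r, h x.2.2 < h x.2.1) :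
    (univ.filter fun X : BinTensor k N => Compatible X M).card * 2 ^ (∏ s, (G s).card) ≤
      2 ^ (N ^ k) := by
  set A : Fin k → Finset (Fin N) := fun s => (G s).image fun x => x.2.1 with hA
  have hmem : ∀ s, ∀ a ∈ A s, ∃ b, (s, a, b) ∈ G s := by
    intro s a ha
    obtain ⟨⟨s', a', b⟩, hx, rfl⟩ := Finset.mem_image.1 ha
    obtain rfl : s' = s := (Finset.mem_filter.1 (hGM s hx)).2
    exact ⟨b, hx⟩
  have hcard : ∀ s, (A s).card = (G s).card := by
    intro s
    refine Finset.card_image_of_injOn ?_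
    rintro ⟨s1, a1, b1⟩ h1 ⟨s2, a2, b2⟩ h2 hab
    obtain ⟨m1, e1⟩ := Finset.mem_filter.1 (hGM s h1)
    obtain ⟨m2, e2⟩ := Finset.mem_filter.1 (hGM s h2)
    dsimp only at e1 e2 hab
    subst e1 e2 hab
    rw [hM _ _ _ _ m1 m2]
  choose! g hg using hmem
  have hle := card_filter_eq_comp_mul_two_pow_le (Fintype.piFinset A)
    (fun u s => g s (u s)) (fun u => h (u r)) (fun u hu =>
      hr _ (hg r (u r) (Fintype.mem_piFinset.1 hu r)))
  rw [Fintype.card_piFinset, Fintype.card_fun, Fintype.card_fin, Fintype.card_fin] at hle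
  simp_rw [hcard] at hle
  refine le_trans (Nat.mul_le_mul_right _ (Finset.card_le_card ?_)) hle
  intro X hX
  simp only [mem_filter, mem_univ, true_and] at hX ⊢
  exact fun u hu => hX _ _ fun s =>
    (Finset.mem_filter.1 (hGM s (hg s (u s) (Fintype.mem_piFinset.1 hu s)))).1

open Classical in
/-- Few tensors are compatible with a matching that has many wrong pairs. -/
theorem exists_card_compatible_mul_le {k N l : ℕ} (hk : 2 ≤ k) {M : Matching k N}
    (hM : RightUnique M) (hl : ∀ r, l ≤ (fiber M r).card) :
    ∃ d, (univ.filter fun X : BinTensor k N => Compatible X M).card * 2 ^ d ≤ 2 ^ (N ^ k) ∧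
      (M.filter fun x => x.2.1 ≠ x.2.2).card * l ≤ 2 * k * d := by
  have : Nonempty (Fin k) := ⟨⟨0, by omega⟩⟩
  set F := M.filter fun x => x.2.1 ≠ x.2.2 with hF
  set c : Fin k × Fin N × Fin N → Fin k × Bool := fun x => (x.1, decide (x.2.1 < x.2.2)) with hc
  -- Pigeonhole over the 2k classes given by the dimension of a pair and by whether its first index
  -- is below its second.
  obtain ⟨⟨r, o⟩, hro⟩ : ∃ y : Fin k × Bool,
      F.card ≤ 2 * k * (F.filter fun x => c x = y).card := by
    by_contra hcon
    push Not at hcon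
    have h1 : F.card = ∑ y : Fin k × Bool, (F.filter fun x => c x = y).card :=
      Finset.card_eq_sum_card_fiberwise fun _ _ => by simp
    have h2 : ∑ y : Fin k × Bool, 2 * k * (F.filter fun x => c x = y).card <
        ∑ _y : Fin k × Bool, F.card :=
      Finset.sum_lt_sum_of_nonempty Finset.univ_nonempty fun y _ => hcon y
    rw [← Finset.mul_sum, ← h1] at h2
    simp [mul_comm] at h2
  set E := F.filter fun x => c x = (r, o) with hE
  set G : Fin k → Matching k N := Function.update (fiber M) r E with hG
  have hEM : E ⊆ fiber M r := by
    intro x hx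
    simp only [hE, hF, hc, mem_filter, Prod.mk.injEq] at hx
    exact Finset.mem_filter.2 ⟨hx.1.1, hx.2.1⟩
  have hGM : ∀ s, G s ⊆ fiber M s := by
    intro s
    by_cases hs : s = r
    · subst hs; simpa [hG] using hEM
    · simp [hG, hs]
  have hprod : E.card * l ≤ ∏ s, (G s).card := by
    rw [← Finset.mul_prod_erase _ _ (Finset.mem_univ r)]
    have hGr : G r = E := by simp [hG]
    rw [hGr]
    refine Nat.mul_le_mul_left _ ?_
    rcases Nat.eq_zero_or_pos l with rfl | hpos
    · exact Nat.zero_le _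
    -- As k ≥ 2, some dimension other than `r` remains and contributes a factor `l`.
    · calc l ≤ l ^ (univ.erase r).card := by
            refine Nat.le_self_pow ?_ l
            rw [Finset.card_erase_of_mem (Finset.mem_univ r), Finset.card_univ, Fintype.card_fin]
            omega
        _ ≤ ∏ s ∈ univ.erase r, (G s).card := by
            refine Finset.pow_card_le_prod _ _ _ fun s hs => ?_
            rw [hG, Function.update_of_ne (Finset.ne_of_mem_erase hs)]
            exact hl s
  refine ⟨∏ s, (G s).card, ?_, ?_⟩
  · cases o with
    | true =>
      refine card_compatible_mul_le hM G hGM (β := (Fin N)ᵒᵈ) OrderDual.toDual r fun x hx => ?_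
      simp only [hG, Function.update_self, hE, hc, mem_filter, Prod.mk.injEq,
        decide_eq_true_eq] at hx
      exact hx.2.2
    | false =>
      refine card_compatible_mul_le hM G hGM (β := Fin N) id r fun x hx => ?_
      simp only [hG, Function.update_self, hE, hF, hc, mem_filter, Prod.mk.injEq,
        decide_eq_false_iff_not, not_lt] at hx
      exact lt_of_le_of_ne hx.2.2 (Ne.symm hx.1.2)
  · calc F.card * l ≤ 2 * k * E.card * l := Nat.mul_le_mul_right _ hro
      _ = 2 * k * (E.card * l) := by ring
      _ ≤ _ := Nat.mul_le_mul_left _ hprod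

/-- The true matching between two patterns. -/
def trueMatching {k N : ℕ} (P Q : Pattern k N) : Matching k N :=
  univ.filter fun x => x.2.1 = x.2.2 ∧ x.2.1 ∈ P x.1 ∧ x.2.1 ∈ Q x.1

/-- A matching between two patterns that matches wrong indices, not fewer than it misses. -/
structure BadMatching {k N : ℕ} (P Q : Pattern k N) (l : ℕ) (M : Matching k N) : Prop where
  rightUnique : RightUnique M
  le_card_fiber : ∀ r, l ≤ (fiber M r).card
  mem_left : ∀ x ∈ M, x.2.1 ∈ P x.1
  mem_right : ∀ x ∈ M, x.2.2 ∈ Q x.1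
  ne : M ≠ trueMatching P Q
  card_le : (trueMatching P Q \ M).card ≤ (M \ trueMatching P Q).card

open Classical in
-- The bound is expressed through the symmetric difference with the true matching, which determines
-- `M`. At least half of that difference consists of wrong pairs, by `card_le`, which turns the 2k
-- of the pigeonhole into 4k.
theorem card_compatible_badMatching {k N l : ℕ} (hk : 2 ≤ k) {P Q : Pattern k N}
    {M : Matching k N} (hM : BadMatching P Q l M) :
    ((univ.filter fun X : BinTensor k N => Compatible X M).card : ℝ) / 2 ^ (N ^ k) ≤
      ((1 / 2) ^ (l / (4 * k))) ^ (symmDiff M (trueMatching P Q)).card := by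
  obtain ⟨d, h1, h2⟩ := exists_card_compatible_mul_le hk hM.rightUnique hM.le_card_fiber
  have hF : (M.filter fun x => x.2.1 ≠ x.2.2) = M \ trueMatching P Q := by
    ext x
    simp only [mem_filter, Finset.mem_sdiff, trueMatching, mem_univ, true_and, not_and]
    constructor
    · rintro ⟨hx, hne⟩
      exact ⟨hx, fun h => absurd h hne⟩
    · rintro ⟨hx, h⟩
      refine ⟨hx, fun he => h he (hM.mem_left x hx) ?_⟩
      rw [he]
      exact hM.mem_right x hx
  rw [hF] at h2
  have h3 : (symmDiff M (trueMatching P Q)).card ≤ 2 * (M \ trueMatching P Q).card := by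
    have h5 : symmDiff M (trueMatching P Q) = (M \ trueMatching P Q) ∪ (trueMatching P Q \ M) := rfl
    have := Finset.card_union_le (M \ trueMatching P Q) (trueMatching P Q \ M)
    have := hM.card_le
    rw [h5]
    omega
  set G := (symmDiff M (trueMatching P Q)).card
  have hd : l / (4 * k) * G ≤ d := by
    have h4 : 4 * k * (l / (4 * k) * G) ≤ 4 * k * d := by
      calc 4 * k * (l / (4 * k) * G) = (4 * k * (l / (4 * k))) * G := by ring
        _ ≤ l * (2 * (M \ trueMatching P Q).card) :=
          Nat.mul_le_mul (Nat.mul_div_le l (4 * k)) h3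
        _ = 2 * ((M \ trueMatching P Q).card * l) := by ring
        _ ≤ 2 * (2 * k * d) := Nat.mul_le_mul_left _ h2
        _ = 4 * k * d := by ring
    exact Nat.le_of_mul_le_mul_left h4 (by omega)
  rw [← pow_mul, one_div, inv_pow, div_le_iff₀ (by positivity), ← div_eq_inv_mul,
    le_div_iff₀ (by positivity)]
  calc ((univ.filter fun X : BinTensor k N => Compatible X M).card : ℝ) * 2 ^ (l / (4 * k) * G)
      ≤ (univ.filter fun X : BinTensor k N => Compatible X M).card * 2 ^ d := by
        gcongr
        norm_num
    _ ≤ 2 ^ (N ^ k) := by exact_mod_cast h1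

open Classical in
/-- A random tensor is unlikely to be compatible with any bad matching between two patterns. -/
theorem card_exists_badMatching {k N l : ℕ} (hk : 2 ≤ k) (P Q : Pattern k N) :
    ((univ.filter fun X : BinTensor k N => ∃ M, BadMatching P Q l M ∧ Compatible X M).card : ℝ) /
      2 ^ (N ^ k) ≤ (1 + (1 / 2) ^ (l / (4 * k))) ^ (k * N ^ 2) - 1 := by
  set x : ℝ := (1 / 2) ^ (l / (4 * k)) with hx
  have hx0 : 0 ≤ x := by positivity
  have hsum : ∑ G : Matching k N, x ^ G.card = (1 + x) ^ (k * N ^ 2) := by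
    have := Finset.sum_pow_mul_eq_add_pow x 1 (univ : Finset (Fin k × Fin N × Fin N))
    simp only [one_pow, mul_one, powerset_univ, card_univ, Fintype.card_prod,
      Fintype.card_fin] at this
    rw [this, add_comm, pow_two]
  have hsum' : ∑ M : Matching k N, x ^ (symmDiff M (trueMatching P Q)).card =
      (1 + x) ^ (k * N ^ 2) := by
    rw [← hsum]
    -- Symmetric difference with a fixed set is an involution, so the sum reduces to the binomial
    -- expansion.
    refine Fintype.sum_bijective (fun M => symmDiff M (trueMatching P Q)) ?_ _ _ fun M => rfl
    exact (symmDiff_left_involutive (trueMatching P Q)).bijective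
  have hsub : (univ.filter fun X : BinTensor k N => ∃ M, BadMatching P Q l M ∧ Compatible X M) ⊆
      (univ.filter fun M : Matching k N => BadMatching P Q l M).biUnion fun M =>
        univ.filter fun X : BinTensor k N => Compatible X M := by
    intro X hX
    simpa using hX
  calc _ ≤ ((∑ M ∈ univ.filter fun M : Matching k N => BadMatching P Q l M,
          (univ.filter fun X : BinTensor k N => Compatible X M).card : ℕ) : ℝ) / 2 ^ (N ^ k) := by
        gcongr
        exact (Finset.card_le_card hsub).trans Finset.card_biUnion_le
    _ = ∑ M ∈ univ.filter fun M : Matching k N => BadMatching P Q l M,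
          ((univ.filter fun X : BinTensor k N => Compatible X M).card : ℝ) / 2 ^ (N ^ k) := by
        rw [Nat.cast_sum, Finset.sum_div]
    _ ≤ ∑ M ∈ univ.filter fun M : Matching k N => BadMatching P Q l M,
          x ^ (symmDiff M (trueMatching P Q)).card :=
        Finset.sum_le_sum fun M hM => card_compatible_badMatching hk (Finset.mem_filter.1 hM).2
    _ ≤ ∑ M ∈ univ.erase (trueMatching P Q), x ^ (symmDiff M (trueMatching P Q)).card := by
        refine Finset.sum_le_sum_of_subset_of_nonneg ?_ fun _ _ _ => by positivity
        intro M hM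
        exact Finset.mem_erase.2 ⟨(Finset.mem_filter.1 hM).2.ne, Finset.mem_univ _⟩
    _ = (1 + x) ^ (k * N ^ 2) - 1 := by
        rw [← hsum', ← Finset.add_sum_erase univ _ (Finset.mem_univ (trueMatching P Q))]
        simp

end TensorReconstruction

namespace TensorReconstruction

open Finset

/-! ### The estimator -/

/-- Equal traces have equal side lengths, so the i-th survivor of `S' r` can be sent to the i-th
survivor of `S r`. Outside `S' r` the value of `φ` is a dummy. -/
theorem exists_reindex_of_traceOf_eq {k N : ℕ} {X X' : BinTensor k N} {S S' : Pattern k N}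
    (h : traceOf X' S' = traceOf X S) :
    ∃ φ : Fin k → Fin N → Fin N, (∀ r, ∀ i ∈ S' r, φ r i ∈ S r) ∧
      (∀ r, ∀ i ∈ S' r, ∀ j ∈ S' r, i < j → φ r i < φ r j) ∧
      ∀ u : Fin k → Fin N, (∀ r, u r ∈ S' r) → X' u = X fun r => φ r (u r) := by
  -- Side lengths are generalized to variables so that the equality of dependent pairs can be
  -- eliminated.
  have gen : ∀ (d d' : Fin k → ℕ) (f : ((r : Fin k) → Fin (d r)) → Bool)
      (f' : ((r : Fin k) → Fin (d' r)) → Bool), (⟨d', f'⟩ : Trace k) = ⟨d, f⟩ →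
      ∃ hd : ∀ r, d' r = d r, ∀ i, f' i = f fun r => Fin.cast (hd r) (i r) := by
    intro d d' f f' e
    cases e
    exact ⟨fun _ => rfl, fun _ => rfl⟩
  obtain ⟨hd, hX⟩ := gen _ _ _ _ h
  refine ⟨fun r i => if hi : i ∈ S' r then
    (S r).orderEmbOfFin rfl (Fin.cast (hd r) (((S' r).orderIsoOfFin rfl).symm ⟨i, hi⟩)) else i,
    ?_, ?_, ?_⟩
  · intro r i hi
    dsimp only
    rw [dif_pos hi]
    exact Finset.orderEmbOfFin_mem _ _ _
  · intro r i hi j hj hij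
    dsimp only
    rw [dif_pos hi, dif_pos hj, OrderEmbedding.lt_iff_lt, Fin.cast_lt_cast, OrderIso.lt_iff_lt]
    exact hij
  · intro u hu
    have := hX fun r => ((S' r).orderIsoOfFin rfl).symm ⟨u r, hu r⟩
    simp only [hu, dif_pos]
    rw [← this]
    congr 1
    funext r
    rw [← Finset.coe_orderIsoOfFin_apply, OrderIso.apply_symm_apply]

/-- The families of patterns in which any two traces in `J` share `l` indices along every
dimension and any `k` cells are retained together in some trace in `J`. -/
structure GoodFamily {k N m : ℕ} (J : Finset (Fin m)) (l : ℕ) (S : Fin m → Pattern k N) : Prop where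
  le_overlap : ∀ t ∈ J, ∀ s ∈ J, t ≠ s → ∀ r, l ≤ (S t r ∩ S s r).card
  exists_retain : ∀ f : Fin k → Fin k × Fin N, ∃ t ∈ J, ∀ j, (f j).2 ∈ S t (f j).1

/-- The total number of indices shared by pairs of traces in `J`. -/
def totalOverlap {k N m : ℕ} (J : Finset (Fin m)) (S : Fin m → Pattern k N) : ℕ :=
  ∑ x ∈ J ×ˢ J, ∑ r, (S x.1 r ∩ S x.2 r).card

theorem card_eq_sum_fiber {k N : ℕ} (M : Matching k N) : M.card = ∑ r, (fiber M r).card :=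
  Finset.card_eq_sum_card_fiberwise fun _ _ => by simp

theorem card_trueMatching {k N : ℕ} (P Q : Pattern k N) :
    (trueMatching P Q).card = ∑ r, (P r ∩ Q r).card := by
  rw [card_eq_sum_fiber]
  refine Finset.sum_congr rfl fun r _ => ?_
  have : fiber (trueMatching P Q) r = (P r ∩ Q r).image fun i => (r, i, i) := by
    ext ⟨r', a, b⟩
    simp only [fiber, trueMatching, mem_filter, mem_univ, true_and, mem_image, mem_inter,
      Prod.mk.injEq]
    constructor
    · rintro ⟨⟨rfl, h⟩, rfl⟩
      exact ⟨a, h, rfl, rfl, rfl⟩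
    · rintro ⟨i, h, rfl, rfl, rfl⟩
      exact ⟨⟨rfl, h⟩, rfl⟩
  rw [this, Finset.card_image_of_injective]
  intro i j hij
  simpa using hij

/-- A tensor without compatible bad matchings is determined by its traces, by maximality of the
total overlap. -/
theorem eq_of_totalOverlap_le {k N m l : ℕ} (hk : 2 ≤ k) {J : Finset (Fin m)}
    {X X' : BinTensor k N} {S S' : Fin m → Pattern k N}
    (hX : ∀ t ∈ J, ∀ s ∈ J, t ≠ s → ¬ ∃ M, BadMatching (S t) (S s) l M ∧ Compatible X M)
    (htr : ∀ t ∈ J, traceOf X' (S' t) = traceOf X (S t)) (hS' : GoodFamily J l S')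
    (hle : totalOverlap J S ≤ totalOverlap J S') : X' = X := by
  have : Nonempty (Fin k → Fin N → Fin N) := ⟨fun _ => id⟩
  have hφ := fun t ht => exists_reindex_of_traceOf_eq (htr t ht)
  choose! φ hφmem hφlt hφX using hφ
  have hinj : ∀ t ∈ J, ∀ r, Set.InjOn (φ t r) (S' t r) := by
    intro t ht r i hi j hj hij
    rcases lt_trichotomy i j with h | h | h
    · exact absurd hij (hφlt t ht r i hi j hj h).ne
    · exact h
    · exact absurd hij (hφlt t ht r j hj i hi h).ne'
  set M : Fin m × Fin m → Matching k N := fun x =>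
    (univ.filter fun y : Fin k × Fin N => y.2 ∈ S' x.1 y.1 ∧ y.2 ∈ S' x.2 y.1).image
      fun y => (y.1, φ x.1 y.1 y.2, φ x.2 y.1 y.2) with hMdef
  have hmem : ∀ x r a b, (r, a, b) ∈ M x ↔
      ∃ i, i ∈ S' x.1 r ∧ i ∈ S' x.2 r ∧ φ x.1 r i = a ∧ φ x.2 r i = b := by
    intro x r a b
    simp only [hMdef, mem_image, mem_filter, mem_univ, true_and, Prod.mk.injEq, Prod.exists]
    constructor
    · rintro ⟨r', i, ⟨h1, h2⟩, rfl, h3, h4⟩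
      exact ⟨i, h1, h2, h3, h4⟩
    · rintro ⟨i, h1, h2, h3, h4⟩
      exact ⟨r, i, ⟨h1, h2⟩, rfl, h3, h4⟩
  have hfib : ∀ x ∈ J ×ˢ J, ∀ r, (fiber (M x) r).card = (S' x.1 r ∩ S' x.2 r).card := by
    intro x hx r
    obtain ⟨h1, h2⟩ := Finset.mem_product.1 hx
    have : fiber (M x) r = (S' x.1 r ∩ S' x.2 r).image fun i => (r, φ x.1 r i, φ x.2 r i) := by
      ext ⟨r', a, b⟩
      rw [fiber, mem_filter, hmem]
      simp only [mem_image, mem_inter, Prod.mk.injEq]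
      constructor
      · rintro ⟨⟨i, h1, h2, h3, h4⟩, rfl⟩
        exact ⟨i, ⟨h1, h2⟩, rfl, h3, h4⟩
      · rintro ⟨i, ⟨h1, h2⟩, rfl, h3, h4⟩
        exact ⟨⟨i, h1, h2, h3, h4⟩, rfl⟩
    rw [this]
    refine Finset.card_image_of_injOn fun i hi j hj hij => ?_
    rw [Prod.mk.injEq, Prod.mk.injEq] at hij
    exact hinj _ h1 r (Finset.mem_inter.1 hi).1 (Finset.mem_inter.1 hj).1 hij.2.1
  have hcomp : ∀ x ∈ J ×ˢ J, Compatible X (M x) := by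
    intro x hx u v huv
    obtain ⟨h1, h2⟩ := Finset.mem_product.1 hx
    choose i hi1 hi2 hi3 hi4 using fun r => (hmem x r _ _).1 (huv r)
    have e1 := hφX _ h1 i hi1
    have e2 := hφX _ h2 i hi2
    simp_rw [hi3] at e1
    simp_rw [hi4] at e2
    exact e1.symm.trans e2
  -- For equal traces the matching is diagonal, hence contained in the true one. For distinct
  -- traces, a failure of both alternatives would make it a bad matching.
  have hdich : ∀ x ∈ J ×ˢ J, M x = trueMatching (S x.1) (S x.2) ∨
      (M x).card < (trueMatching (S x.1) (S x.2)).card := by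
    rintro ⟨t, s⟩ hx
    obtain ⟨h1, h2⟩ := Finset.mem_product.1 hx
    dsimp only at h1 h2 ⊢
    rcases eq_or_ne t s with rfl | hts
    · have hsub : M (t, t) ⊆ trueMatching (S t) (S t) := by
        rintro ⟨r, a, b⟩ hab
        obtain ⟨i, hi1, -, rfl, rfl⟩ := (hmem _ _ _ _).1 hab
        have := hφmem t h1 r i hi1
        simp [trueMatching, this]
      rcases hsub.eq_or_ssubset with h | h
      · exact Or.inl h
      · exact Or.inr (Finset.card_lt_card h)
    · by_contra hcon
      push Not at hcon
      refine hX t h1 s h2 hts ⟨M (t, s), ⟨?_, ?_, ?_, ?_, hcon.1, ?_⟩, hcomp _ hx⟩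
      · intro r a b b' hb hb'
        obtain ⟨i, hi1, hi2, hia, rfl⟩ := (hmem _ _ _ _).1 hb
        obtain ⟨j, hj1, hj2, hja, rfl⟩ := (hmem _ _ _ _).1 hb'
        rw [hinj t h1 r hi1 hj1 (hia.trans hja.symm)]
      · intro r
        rw [hfib _ hx]
        exact hS'.le_overlap t h1 s h2 hts r
      · rintro ⟨r, a, b⟩ hab
        obtain ⟨i, hi1, hi2, rfl, rfl⟩ := (hmem _ _ _ _).1 hab
        exact hφmem t h1 r i hi1
      · rintro ⟨r, a, b⟩ hab
        obtain ⟨i, hi1, hi2, rfl, rfl⟩ := (hmem _ _ _ _).1 hab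
        exact hφmem s h2 r i hi2
      · have e1 := Finset.card_sdiff_add_card_inter (M (t, s)) (trueMatching (S t) (S s))
        have e2 := Finset.card_sdiff_add_card_inter (trueMatching (S t) (S s)) (M (t, s))
        rw [Finset.inter_comm] at e2
        have := hcon.2
        omega
  -- The sizes of the matchings add up to the total overlap of `S'`, which is at least that of `S`,
  -- so no matching can be strictly smaller.
  have heq : ∀ x ∈ J ×ˢ J, M x = trueMatching (S x.1) (S x.2) := by
    have hcard : ∀ x ∈ J ×ˢ J, (M x).card ≤ (trueMatching (S x.1) (S x.2)).card := by
      intro x hx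
      rcases hdich x hx with h | h
      · rw [h]
      · exact h.le
    have hsum : ∑ x ∈ J ×ˢ J, (M x).card =
        ∑ x ∈ J ×ˢ J, (trueMatching (S x.1) (S x.2)).card := by
      refine le_antisymm (Finset.sum_le_sum hcard) ?_
      simp_rw [card_trueMatching]
      refine hle.trans (le_of_eq (Finset.sum_congr rfl fun x hx => ?_))
      rw [card_eq_sum_fiber]
      exact Finset.sum_congr rfl fun r _ => (hfib x hx r).symm
    intro x hx
    have := (Finset.sum_eq_sum_iff_of_le hcard).1 hsum x hx
    rcases hdich x hx with h | h
    · exact h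
    · exact absurd this h.ne
  have hagree : ∀ t ∈ J, ∀ s ∈ J, ∀ r, ∀ i ∈ S' t r, i ∈ S' s r → φ t r i = φ s r i := by
    intro t ht s hs r i hi1 hi2
    have h1 : (r, φ t r i, φ s r i) ∈ M (t, s) := (hmem _ _ _ _).2 ⟨i, hi1, hi2, rfl, rfl⟩
    rw [heq _ (Finset.mk_mem_product ht hs)] at h1
    exact (Finset.mem_filter.1 h1).2.1
  have hpair : ∀ r i j, ∃ t ∈ J, i ∈ S' t r ∧ j ∈ S' t r := by
    intro r i j
    -- Since k ≥ 2, a list of k cells has room for both prescribed cells.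
    obtain ⟨t, ht, h⟩ := hS'.exists_retain fun s => if s.1 = 0 then (r, i) else (r, j)
    refine ⟨t, ht, ?_, ?_⟩
    · simpa using h ⟨0, by omega⟩
    · simpa using h ⟨1, by omega⟩
  choose τ hτJ hτ using fun r i => hpair r i i
  -- Two indices are compared inside one trace that retains both, where the reindexing is
  -- increasing.
  have hmono : ∀ r, StrictMono fun i => φ (τ r i) r i := by
    intro r i j hij
    obtain ⟨t, ht, hi, hj⟩ := hpair r i j
    dsimp only
    rw [hagree _ (hτJ r i) t ht r i (hτ r i).1 hi, hagree _ (hτJ r j) t ht r j (hτ r j).1 hj]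
    exact hφlt t ht r i hi j hj hij
  have hid : ∀ r i, φ (τ r i) r i = i := fun r i => congrFun (hmono r).eq_id i
  funext u
  obtain ⟨t, ht, h⟩ := hS'.exists_retain fun r => (r, u r)
  rw [hφX t ht u h]
  congr 1
  funext r
  rw [← hagree _ (hτJ r (u r)) t ht r (u r) (hτ r (u r)).1 (h r), hid]

/-- An estimator that outputs a tensor explaining the traces in `J` by a good family of patterns
with maximal total overlap. -/
theorem exists_estimator {k N m l : ℕ} (hk : 2 ≤ k) (J : Finset (Fin m)) :
    ∃ est : Estimator k N m, ∀ (X : BinTensor k N) (S : Fin m → Pattern k N), GoodFamily J l S →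
      (∀ t ∈ J, ∀ s ∈ J, t ≠ s → ¬ ∃ M, BadMatching (S t) (S s) l M ∧ Compatible X M) →
      est (fun t => traceOf X (S t)) = X := by
  classical
  have h : ∀ T : Fin m → Trace k, ∃ X' : BinTensor k N, ∀ (X : BinTensor k N)
      (S : Fin m → Pattern k N), GoodFamily J l S → (∀ t ∈ J, traceOf X (S t) = T t) →
      ∃ S', GoodFamily J l S' ∧ (∀ t ∈ J, traceOf X' (S' t) = T t) ∧
        totalOverlap J S ≤ totalOverlap J S' := by
    intro T
    set A : Finset (BinTensor k N × (Fin m → Pattern k N)) := univ.filter fun y =>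
      GoodFamily J l y.2 ∧ ∀ t ∈ J, traceOf y.1 (y.2 t) = T t with hA
    rcases A.eq_empty_or_nonempty with h0 | h0
    · refine ⟨fun _ => false, fun X S h1 h2 => ?_⟩
      have : (X, S) ∈ A := Finset.mem_filter.2 ⟨Finset.mem_univ _, h1, h2⟩
      simp [h0] at this
    · obtain ⟨⟨X', S'⟩, hy, hmax⟩ := Finset.exists_max_image A (fun y => totalOverlap J y.2) h0
      have hy' := (Finset.mem_filter.1 hy).2
      refine ⟨X', fun X S h1 h2 => ⟨S', hy'.1, hy'.2, hmax (X, S) ?_⟩⟩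
      exact Finset.mem_filter.2 ⟨Finset.mem_univ _, h1, h2⟩
  choose est hest using h
  refine ⟨est, fun X S hS hX => ?_⟩
  obtain ⟨S', h1, h2, h3⟩ := hest _ X S hS fun _ _ => rfl
  exact eq_of_totalOverlap_le hk hX h2 h1 h3

open Classical in
-- Union bound over the (kN)^k lists of cells, and over pairs of traces and dimensions for the
-- overlaps.
theorem sum_familyProb_not_goodFamily {k N m : ℕ} {p : ℝ} (h0 : 0 ≤ p) (h1 : p ≤ 1)
    (J : Finset (Fin m)) (l : ℕ) :
    ∑ S : Fin m → Pattern k N, familyProb p S * (if GoodFamily J l S then 0 else 1) ≤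
      (k * N) ^ k * (1 - (1 - p) ^ k) ^ J.card +
        J.card ^ 2 * (k * (2 ^ l * (1 - (1 - p) ^ 2 / 2) ^ N)) := by
  have hle : ∀ S : Fin m → Pattern k N, (if GoodFamily J l S then (0 : ℝ) else 1) ≤
      (∑ f : Fin k → Fin k × Fin N,
        if ∀ t ∈ J, ¬ ∀ c ∈ univ.image f, c.2 ∈ S t c.1 then 1 else 0) +
      ∑ x ∈ J.offDiag, ∑ r, if (S x.1 r ∩ S x.2 r).card < l then 1 else 0 := by
    intro S
    have n1 : ∀ f ∈ (univ : Finset (Fin k → Fin k × Fin N)),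
        (0 : ℝ) ≤ if ∀ t ∈ J, ¬ ∀ c ∈ univ.image f, c.2 ∈ S t c.1 then 1 else 0 :=
      fun f _ => by split_ifs <;> norm_num
    have n3 : ∀ x ∈ J.offDiag, ∀ r ∈ (univ : Finset (Fin k)),
        (0 : ℝ) ≤ if (S x.1 r ∩ S x.2 r).card < l then 1 else 0 :=
      fun x _ r _ => by split_ifs <;> norm_num
    have n2 := fun x hx => Finset.sum_nonneg (n3 x hx)
    split_ifs with hS
    · exact add_nonneg (Finset.sum_nonneg n1) (Finset.sum_nonneg n2)
    · by_cases hc : ∀ f : Fin k → Fin k × Fin N, ∃ t ∈ J, ∀ j, (f j).2 ∈ S t (f j).1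
      · have : ∃ t ∈ J, ∃ s ∈ J, t ≠ s ∧ ∃ r, (S t r ∩ S s r).card < l := by
          by_contra hcon
          push Not at hcon
          exact hS ⟨hcon, hc⟩
        obtain ⟨t, ht, s, hs, hts, r, hr⟩ := this
        have hx : (t, s) ∈ J.offDiag := Finset.mem_offDiag.2 ⟨ht, hs, hts⟩
        have e1 := Finset.single_le_sum n2 hx
        have e2 := Finset.single_le_sum (n3 _ hx) (Finset.mem_univ r)
        rw [if_pos hr] at e2
        have := Finset.sum_nonneg n1
        linarith
      · push Not at hc
        obtain ⟨f, hf⟩ := hc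
        have e1 := Finset.single_le_sum n1 (Finset.mem_univ f)
        rw [if_pos] at e1
        · have := Finset.sum_nonneg n2
          linarith
        · intro t ht hcon
          obtain ⟨j, hj⟩ := hf t ht
          exact hj (hcon _ (Finset.mem_image_of_mem _ (Finset.mem_univ j)))
  have hq0 : 0 ≤ 1 - p := by linarith
  have hq1 : 1 - p ≤ 1 := by linarith
  calc _ ≤ ∑ S : Fin m → Pattern k N, familyProb p S *
        ((∑ f : Fin k → Fin k × Fin N,
          if ∀ t ∈ J, ¬ ∀ c ∈ univ.image f, c.2 ∈ S t c.1 then 1 else 0) +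
        ∑ x ∈ J.offDiag, ∑ r, if (S x.1 r ∩ S x.2 r).card < l then 1 else 0) :=
        Finset.sum_le_sum fun S _ =>
          mul_le_mul_of_nonneg_left (hle S) (familyProb_nonneg h0 h1 S)
    _ = (∑ f : Fin k → Fin k × Fin N, ∑ S : Fin m → Pattern k N, familyProb p S *
          if ∀ t ∈ J, ¬ ∀ c ∈ univ.image f, c.2 ∈ S t c.1 then 1 else 0) +
        ∑ x ∈ J.offDiag, ∑ r, ∑ S : Fin m → Pattern k N, familyProb p S *
          if (S x.1 r ∩ S x.2 r).card < l then 1 else 0 := by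
        simp_rw [mul_add, Finset.sum_add_distrib, Finset.mul_sum]
        rw [Finset.sum_comm]
        congr 1
        rw [Finset.sum_comm]
        exact Finset.sum_congr rfl fun x _ => Finset.sum_comm
    _ ≤ (∑ f : Fin k → Fin k × Fin N, (1 - (1 - p) ^ k) ^ J.card) +
        ∑ x ∈ J.offDiag, ∑ r : Fin k, 2 ^ l * (1 - (1 - p) ^ 2 / 2) ^ N := by
        refine add_le_add (Finset.sum_le_sum fun f _ => ?_) (Finset.sum_le_sum fun x hx =>
          Finset.sum_le_sum fun r _ =>
            sum_familyProb_overlap h0 h1 (Finset.mem_offDiag.1 hx).2.2 r l)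
        rw [sum_familyProb_miss]
        -- Repeated cells in the list only make joint retention more likely.
        have : (univ.image f).card ≤ k := Finset.card_image_le.trans (by simp)
        have := pow_le_pow_of_le_one hq0 hq1 this
        have := pow_le_one₀ (n := (univ.image f).card) hq0 hq1
        exact pow_le_pow_left₀ (by linarith) (by linarith) _
    _ ≤ _ := by
        rw [Finset.sum_const, Finset.sum_const, Finset.sum_const, Finset.card_univ,
          Finset.card_univ, Fintype.card_fun, Fintype.card_prod, Fintype.card_fin, Fintype.card_fin,
          nsmul_eq_mul, nsmul_eq_mul, nsmul_eq_mul]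
        push_cast
        have h2 : (J.offDiag.card : ℝ) ≤ J.card ^ 2 := by
          rw [Finset.offDiag_card, pow_two]
          exact_mod_cast Nat.sub_le _ _
        have h3 : 0 ≤ 1 - (1 - p) ^ 2 / 2 := by nlinarith
        gcongr

theorem card_binTensor (k N : ℕ) : (Fintype.card (BinTensor k N) : ℝ) = 2 ^ (N ^ k) := by
  simp

open Classical in
/-- Some estimator that uses only the traces in `J` succeeds up to an explicit error. -/
theorem exists_estimator_le_successProb {k N m : ℕ} (hk : 2 ≤ k) {p : ℝ} (h0 : 0 ≤ p)
    (h1 : p ≤ 1) (J : Finset (Fin m)) (l : ℕ) :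
    ∃ est : Estimator k N m,
      1 - ((k * N) ^ k * (1 - (1 - p) ^ k) ^ J.card +
        J.card ^ 2 * (k * (2 ^ l * (1 - (1 - p) ^ 2 / 2) ^ N)) +
        J.card ^ 2 * ((1 + (1 / 2) ^ (l / (4 * k))) ^ (k * N ^ 2) - 1)) ≤ successProb p est := by
  obtain ⟨est, hest⟩ := exists_estimator (N := N) (l := l) hk J
  refine ⟨est, ?_⟩
  set u : ℝ := 1 / 2 ^ (N ^ k) with hu
  have hu0 : 0 ≤ u := by positivity
  set bad : BinTensor k N → (Fin m → Pattern k N) → Fin m × Fin m → Prop := fun X S x =>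
    ∃ M, BadMatching (S x.1) (S x.2) l M ∧ Compatible X M with hbad
  have hpt : ∀ (X : BinTensor k N) (S : Fin m → Pattern k N),
      1 - (if GoodFamily J l S then (0 : ℝ) else 1) -
        ∑ x ∈ J.offDiag, (if bad X S x then 1 else 0) ≤
      if est (fun t => traceOf X (S t)) = X then 1 else 0 := by
    intro X S
    have n1 : ∀ x ∈ J.offDiag, (0 : ℝ) ≤ if bad X S x then 1 else 0 :=
      fun x _ => by split_ifs <;> norm_num
    have n2 := Finset.sum_nonneg n1
    by_cases hE : est (fun t => traceOf X (S t)) = X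
    · rw [if_pos hE]
      split_ifs <;> linarith
    · rw [if_neg hE]
      by_cases hS : GoodFamily J l S
      · have : ∃ x ∈ J.offDiag, bad X S x := by
          by_contra hcon
          push Not at hcon
          exact hE (hest X S hS fun t ht s hs hts =>
            hcon (t, s) (Finset.mem_offDiag.2 ⟨ht, hs, hts⟩))
        obtain ⟨x, hx, hb⟩ := this
        have := Finset.single_le_sum n1 hx
        rw [if_pos hb] at this
        rw [if_pos hS]
        linarith
      · rw [if_neg hS]
        linarith
  have hX1 : ∑ _X : BinTensor k N, u = 1 := by
    rw [Finset.sum_const, Finset.card_univ, nsmul_eq_mul, card_binTensor, hu]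
    field_simp
  have hbadle : ∀ (S : Fin m → Pattern k N),
      ∑ X : BinTensor k N, u * ∑ x ∈ J.offDiag, (if bad X S x then (1 : ℝ) else 0) ≤
      J.card ^ 2 * ((1 + (1 / 2) ^ (l / (4 * k))) ^ (k * N ^ 2) - 1) := by
    intro S
    calc _ = ∑ x ∈ J.offDiag, ((univ.filter fun X => bad X S x).card : ℝ) / 2 ^ (N ^ k) := by
          simp_rw [Finset.mul_sum]
          rw [Finset.sum_comm]
          refine Finset.sum_congr rfl fun x _ => ?_
          rw [← Finset.mul_sum, Finset.sum_boole, hu, div_mul_eq_mul_div, one_mul]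
      _ ≤ ∑ x ∈ J.offDiag, ((1 + (1 / 2 : ℝ) ^ (l / (4 * k))) ^ (k * N ^ 2) - 1) :=
          Finset.sum_le_sum fun x _ => card_exists_badMatching hk _ _
      _ ≤ _ := by
          rw [Finset.sum_const, nsmul_eq_mul]
          have h2 : (J.offDiag.card : ℝ) ≤ J.card ^ 2 := by
            rw [Finset.offDiag_card, pow_two]
            exact_mod_cast Nat.sub_le _ _
          refine mul_le_mul_of_nonneg_right h2 (sub_nonneg.2 (one_le_pow₀ ?_))
          have : (0 : ℝ) ≤ (1 / 2) ^ (l / (4 * k)) := by positivity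
          linarith
  calc _ ≤ 1 - ∑ S : Fin m → Pattern k N, familyProb p S * (if GoodFamily J l S then 0 else 1) -
        ∑ S : Fin m → Pattern k N, familyProb p S *
          (J.card ^ 2 * ((1 + (1 / 2) ^ (l / (4 * k))) ^ (k * N ^ 2) - 1)) := by
        rw [← Finset.sum_mul, sum_familyProb, one_mul]
        have := sum_familyProb_not_goodFamily (k := k) (N := N) h0 h1 J l
        linarith
    _ ≤ 1 - ∑ S : Fin m → Pattern k N, familyProb p S * (if GoodFamily J l S then 0 else 1) -
        ∑ S : Fin m → Pattern k N, familyProb p S *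
          ∑ X : BinTensor k N, u * ∑ x ∈ J.offDiag, (if bad X S x then (1 : ℝ) else 0) := by
        refine sub_le_sub_left (Finset.sum_le_sum fun S _ => ?_) _
        exact mul_le_mul_of_nonneg_left (hbadle S) (familyProb_nonneg h0 h1 S)
    _ = ∑ X : BinTensor k N, ∑ S : Fin m → Pattern k N, u * familyProb p S *
          (1 - (if GoodFamily J l S then (0 : ℝ) else 1) -
            ∑ x ∈ J.offDiag, (if bad X S x then 1 else 0)) := by
        have e : ∀ S : Fin m → Pattern k N, ∑ X : BinTensor k N, u * familyProb p S *
          (1 - (if GoodFamily J l S then (0 : ℝ) else 1) -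
            ∑ x ∈ J.offDiag, (if bad X S x then 1 else 0)) =
            familyProb p S - familyProb p S * (if GoodFamily J l S then (0 : ℝ) else 1) -
            familyProb p S * ∑ X : BinTensor k N, u *
              ∑ x ∈ J.offDiag, (if bad X S x then (1 : ℝ) else 0) := by
          intro S
          have e1 : ∀ X : BinTensor k N, u * familyProb p S *
              (1 - (if GoodFamily J l S then (0 : ℝ) else 1) -
                ∑ x ∈ J.offDiag, (if bad X S x then 1 else 0)) =
              u * (familyProb p S * (1 - (if GoodFamily J l S then (0 : ℝ) else 1))) -
              familyProb p S * (u * ∑ x ∈ J.offDiag, (if bad X S x then 1 else 0)) :=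
            fun X => by ring
          simp_rw [e1]
          rw [Finset.sum_sub_distrib, ← Finset.sum_mul, hX1, ← Finset.mul_sum]
          ring
        rw [Finset.sum_comm]
        simp_rw [e]
        rw [Finset.sum_sub_distrib, Finset.sum_sub_distrib, sum_familyProb]
    _ ≤ successProb p est := by
        unfold successProb
        rw [card_binTensor]
        refine Finset.sum_le_sum fun X _ => Finset.sum_le_sum fun S _ => ?_
        exact mul_le_mul_of_nonneg_left (hpt X S) (mul_nonneg hu0 (familyProb_nonneg h0 h1 S))

end TensorReconstruction

namespace TensorReconstruction

open Finset

/-! ### Unseen entries -/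

/-- The cells of a pattern that have to be retained for the entry `e` to be observed. -/
def cells {k N : ℕ} (e : Fin k → Fin N) : Finset (Fin k × Fin N) := univ.image fun r => (r, e r)

theorem card_cells {k N : ℕ} (e : Fin k → Fin N) : (cells e).card = k := by
  rw [cells, Finset.card_image_of_injective _ fun a b h => (Prod.mk.inj h).1, Finset.card_univ,
    Fintype.card_fin]

theorem forall_mem_cells {k N : ℕ} (e : Fin k → Fin N) (P : Pattern k N) :
    (∀ c ∈ cells e, c.2 ∈ P c.1) ↔ ∀ r, e r ∈ P r := by
  simp [cells]

/-- The number of coordinates in which two entries agree. -/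
def agree {k N : ℕ} (e e' : Fin k → Fin N) : ℕ := (univ.filter fun r => e r = e' r).card

theorem card_cells_union {k N : ℕ} (e e' : Fin k → Fin N) :
    (cells e ∪ cells e').card + agree e e' = 2 * k := by
  have h : cells e ∩ cells e' = (univ.filter fun r => e r = e' r).image fun r => (r, e r) := by
    ext ⟨r, i⟩
    simp only [cells, mem_inter, mem_image, mem_univ, true_and, mem_filter, Prod.mk.injEq]
    constructor
    · rintro ⟨⟨a, rfl, rfl⟩, b, rfl, hb⟩
      exact ⟨b, hb.symm, rfl, rfl⟩
    · rintro ⟨a, ha, rfl, rfl⟩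
      exact ⟨⟨a, rfl, rfl⟩, a, rfl, ha.symm⟩
  have h2 : (cells e ∩ cells e').card = agree e e' := by
    rw [h, Finset.card_image_of_injective _ fun a b h => (Prod.mk.inj h).1, agree]
  have := Finset.card_union_add_card_inter (cells e) (cells e')
  rw [card_cells, card_cells] at this
  omega

/-- The entry `e` is observed in no trace. -/
def Unseen {k N m : ℕ} (S : Fin m → Pattern k N) (e : Fin k → Fin N) : Prop :=
  ∀ t, ¬ ∀ r, e r ∈ S t r

open Classical in
theorem sum_familyProb_unseen {k N m : ℕ} (p : ℝ) (e : Fin k → Fin N) :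
    ∑ S : Fin m → Pattern k N, familyProb p S * (if Unseen S e then 1 else 0) =
      (1 - (1 - p) ^ k) ^ m := by
  have := sum_familyProb_miss (m := m) p univ (cells e)
  rw [card_cells, Finset.card_univ, Fintype.card_fin] at this
  rw [← this]
  refine Finset.sum_congr rfl fun S _ => ?_
  simp only [forall_mem_cells, Unseen, mem_univ, true_imp_iff]
  congr

open Classical in
-- Inclusion–exclusion within each trace: observing both entries requires 2k minus the number of
-- agreements distinct cells.
theorem sum_familyProb_unseen_pair {k N m : ℕ} (p : ℝ) (e e' : Fin k → Fin N) :
    ∑ S : Fin m → Pattern k N, familyProb p S *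
      ((if Unseen S e then 1 else 0) * (if Unseen S e' then 1 else 0)) =
      (1 - 2 * (1 - p) ^ k + (1 - p) ^ (2 * k - agree e e')) ^ m := by
  have h1 : ∀ S : Fin m → Pattern k N,
      ((if Unseen S e then 1 else 0) * (if Unseen S e' then 1 else 0) : ℝ) =
      ∏ t, (1 - (if ∀ c ∈ cells e, c.2 ∈ S t c.1 then 1 else 0) -
        (if ∀ c ∈ cells e', c.2 ∈ S t c.1 then 1 else 0) +
        (if ∀ c ∈ cells e ∪ cells e', c.2 ∈ S t c.1 then 1 else 0)) := by
    intro S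
    have h2 : ∀ e : Fin k → Fin N, (if Unseen S e then (1 : ℝ) else 0) =
        ∏ t, (1 - (if ∀ c ∈ cells e, c.2 ∈ S t c.1 then 1 else 0)) := by
      intro e
      simp only [forall_mem_cells]
      split_ifs with h
      · exact (Finset.prod_eq_one fun t _ => by rw [if_neg (h t), sub_zero]).symm
      · obtain ⟨t, ht⟩ := not_forall.1 h
        rw [Finset.prod_eq_zero (Finset.mem_univ t)]
        rw [if_pos (not_not.1 ht), sub_self]
    rw [h2, h2, ← Finset.prod_mul_distrib]
    refine Finset.prod_congr rfl fun t _ => ?_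
    simp only [mem_union, or_imp, forall_and]
    by_cases ha : ∀ c ∈ cells e, c.2 ∈ S t c.1 <;> by_cases hb : ∀ c ∈ cells e', c.2 ∈ S t c.1
    · rw [if_pos ha, if_pos hb, if_pos ⟨ha, hb⟩]; norm_num
    · rw [if_pos ha, if_neg hb, if_neg fun h => hb h.2]; norm_num
    · rw [if_neg ha, if_pos hb, if_neg fun h => ha h.1]; norm_num
    · rw [if_neg ha, if_neg hb, if_neg fun h => hb h.2]; norm_num
  simp_rw [h1]
  rw [sum_familyProb_mul_prod p fun _ P => (1 - (if ∀ c ∈ cells e, c.2 ∈ P c.1 then 1 else 0) -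
        (if ∀ c ∈ cells e', c.2 ∈ P c.1 then 1 else 0) +
        (if ∀ c ∈ cells e ∪ cells e', c.2 ∈ P c.1 then (1 : ℝ) else 0))]
  rw [Finset.prod_const, Finset.card_univ, Fintype.card_fin]
  congr 1
  simp_rw [mul_add, mul_sub, Finset.sum_add_distrib, Finset.sum_sub_distrib, mul_one]
  rw [sum_patternProb, sum_patternProb_retain, sum_patternProb_retain, sum_patternProb_retain,
    card_cells, card_cells]
  have := card_cells_union e e'
  have h3 : (cells e ∪ cells e').card = 2 * k - agree e e' := by omega
  rw [h3]
  ring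

/-- The weight factors over the coordinates. This evaluates the second moment once correlations are
bounded by a power of the number of agreements. -/
theorem sum_pow_agree (k N : ℕ) (y : ℝ) :
    ∑ e : Fin k → Fin N, ∑ e' : Fin k → Fin N, y ^ agree e e' = (N * (y - 1) + N ^ 2) ^ k := by
  have h : ∀ e e' : Fin k → Fin N, y ^ agree e e' = ∏ r, if e r = e' r then y else 1 := by
    intro e e'
    rw [agree, ← Finset.prod_const, Finset.prod_filter]
  have h2 : ∀ i : Fin N, ∑ j : Fin N, (if i = j then y else 1) = y - 1 + N := by
    intro i
    have : ∀ j : Fin N, (if i = j then y else 1) = (if i = j then y - 1 else 0) + 1 := by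
      intro j; split_ifs <;> ring
    simp_rw [this, Finset.sum_add_distrib]
    simp
  have h3 : ∀ e : Fin k → Fin N, ∑ e' : Fin k → Fin N, y ^ agree e e' = (y - 1 + N) ^ k := by
    intro e
    simp_rw [h]
    have := Finset.prod_univ_sum (fun _ : Fin k => (univ : Finset (Fin N)))
      (fun r j => if e r = j then y else 1)
    rw [Fintype.piFinset_univ] at this
    rw [← this]
    simp_rw [h2]
    simp
  simp_rw [h3]
  simp only [sum_const, card_univ, Fintype.card_fun, Fintype.card_fin, nsmul_eq_mul, Nat.cast_pow]
  rw [← mul_pow]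
  ring

open Classical in
/-- The second moment method for the number of unseen entries. -/
theorem sq_le_mul_sum_familyProb_exists_unseen {k N m : ℕ} {p y : ℝ} (h0 : 0 ≤ p) (h1 : p ≤ 1)
    (hy : ∀ e e' : Fin k → Fin N,
      (1 - 2 * (1 - p) ^ k + (1 - p) ^ (2 * k - agree e e')) ^ m ≤
        ((1 - (1 - p) ^ k) ^ m) ^ 2 * y ^ agree e e') :
    ((N : ℝ) ^ k * (1 - (1 - p) ^ k) ^ m) ^ 2 ≤
      ((1 - (1 - p) ^ k) ^ m) ^ 2 * (N * (y - 1) + N ^ 2) ^ k *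
      ∑ S : Fin m → Pattern k N, familyProb p S * (if ∃ e, Unseen S e then 1 else 0) := by
  set Z : (Fin m → Pattern k N) → ℝ := fun S => ∑ e, if Unseen S e then 1 else 0 with hZ
  have hZ1 : ∑ S : Fin m → Pattern k N, familyProb p S * Z S =
      (N : ℝ) ^ k * (1 - (1 - p) ^ k) ^ m := by
    simp_rw [hZ, Finset.mul_sum]
    rw [Finset.sum_comm]
    simp_rw [sum_familyProb_unseen]
    simp
  have hZ2 : ∑ S : Fin m → Pattern k N, familyProb p S * Z S ^ 2 ≤
      ((1 - (1 - p) ^ k) ^ m) ^ 2 * (N * (y - 1) + N ^ 2) ^ k := by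
    rw [← sum_pow_agree, Finset.mul_sum]
    simp_rw [hZ, pow_two (∑ e, _), Finset.sum_mul_sum, Finset.mul_sum]
    rw [Finset.sum_comm]
    refine Finset.sum_le_sum fun e _ => ?_
    rw [Finset.sum_comm]
    refine Finset.sum_le_sum fun e' _ => ?_
    rw [sum_familyProb_unseen_pair]
    exact hy e e'
  have hw := familyProb_nonneg (k := k) (N := N) (m := m) h0 h1
  have hpos : 0 ≤ ∑ S : Fin m → Pattern k N,
      familyProb p S * (if ∃ e, Unseen S e then (1 : ℝ) else 0) :=
    Finset.sum_nonneg fun S _ => mul_nonneg (hw S) (by split_ifs <;> norm_num)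
  rw [← hZ1]
  refine le_trans ?_ (mul_le_mul_of_nonneg_right hZ2 hpos)
  -- Cauchy–Schwarz applied to `Z` times the indicator that `Z` is nonzero.
  refine Finset.sum_sq_le_sum_mul_sum_of_sq_le_mul _ (fun S _ => mul_nonneg (hw S) (sq_nonneg _))
    (fun S _ => mul_nonneg (hw S) (by split_ifs <;> norm_num)) fun S _ => le_of_eq ?_
  split_ifs with h
  · ring
  · have : Z S = 0 := Finset.sum_eq_zero fun e _ => if_neg fun he => h ⟨e, he⟩
    rw [this]
    ring

theorem traceOf_update_of_not_mem {k N : ℕ} (X : BinTensor k N) (P : Pattern k N)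
    {e : Fin k → Fin N} (he : ¬ ∀ r, e r ∈ P r) (b : Bool) :
    traceOf (Function.update X e b) P = traceOf X P := by
  unfold traceOf
  congr 1
  funext i
  rw [Function.update_of_ne]
  rintro rfl
  exact he fun r => Finset.orderEmbOfFin_mem _ _ _

open Classical in
/-- An unseen entry makes the estimator fail with probability at least one half. -/
theorem successProb_le_of_unseen {k N m : ℕ} {p : ℝ} (h0 : 0 ≤ p) (h1 : p ≤ 1)
    (est : Estimator k N m) :
    successProb p est ≤ 1 - (1 / 2) *
      ∑ S : Fin m → Pattern k N, familyProb p S * (if ∃ e, Unseen S e then 1 else 0) := by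
  set u : ℝ := 1 / 2 ^ (N ^ k) with hu
  have hu0 : 0 ≤ u := by positivity
  have hX1 : ∑ _X : BinTensor k N, u = 1 := by
    rw [Finset.sum_const, Finset.card_univ, nsmul_eq_mul, card_binTensor, hu]
    field_simp
  have key : ∀ S : Fin m → Pattern k N,
      ∑ X : BinTensor k N, u * (if est (fun t => traceOf X (S t)) = X then 1 else 0) ≤
        1 - (1 / 2) * (if ∃ e, Unseen S e then 1 else 0) := by
    intro S
    set F : BinTensor k N → ℝ :=
      fun X => if est (fun t => traceOf X (S t)) = X then 1 else 0 with hF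
    have hF1 : ∀ X, F X ≤ 1 := fun X => by simp only [hF]; split_ifs <;> norm_num
    split_ifs with h
    · obtain ⟨e, he⟩ := h
      set flip : BinTensor k N → BinTensor k N := fun X => Function.update X e (!X e) with hflip
      have hinv : Function.Involutive flip := by
        intro X
        simp [hflip]
      have hsum : ∑ X, F (flip X) = ∑ X, F X := Equiv.sum_comp hinv.toPerm F
      -- A tensor and its flip have the same traces, so the single output is right for at most one
      -- of them.
      have hpair : ∀ X, F X + F (flip X) ≤ 1 := by
        intro X
        have hT : (fun t => traceOf (flip X) (S t)) = fun t => traceOf X (S t) :=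
          funext fun t => traceOf_update_of_not_mem X (S t) (he t) _
        by_cases hX : est (fun t => traceOf X (S t)) = X
        · have hne : est (fun t => traceOf (flip X) (S t)) ≠ flip X := by
            rw [hT, hX]
            intro hcon
            have := congrFun hcon e
            simp [hflip] at this
          have : F (flip X) = 0 := if_neg hne
          rw [this, add_zero]
          exact hF1 X
        · have : F X = 0 := if_neg hX
          rw [this, zero_add]
          exact hF1 _
      have h2 : ∑ X, u * (F X + F (flip X)) ≤ 1 := by
        rw [← hX1]
        exact Finset.sum_le_sum fun X _ => by nlinarith [hpair X]
      rw [← Finset.mul_sum, Finset.sum_add_distrib, hsum] at h2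
      rw [← Finset.mul_sum]
      linarith
    · rw [mul_zero, sub_zero]
      exact (Finset.sum_le_sum fun X _ => mul_le_of_le_one_right hu0 (hF1 X)).trans hX1.le
  calc successProb p est = ∑ S : Fin m → Pattern k N, familyProb p S *
        ∑ X : BinTensor k N, u * (if est (fun t => traceOf X (S t)) = X then 1 else 0) := by
        unfold successProb
        rw [card_binTensor, Finset.sum_comm]
        refine Finset.sum_congr rfl fun S _ => ?_
        rw [Finset.mul_sum]
        refine Finset.sum_congr rfl fun X _ => ?_
        rw [familyProb, hu]
        ring
    _ ≤ ∑ S : Fin m → Pattern k N, familyProb p S *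
          (1 - (1 / 2) * (if ∃ e, Unseen S e then 1 else 0)) :=
        Finset.sum_le_sum fun S _ => mul_le_mul_of_nonneg_left (key S) (familyProb_nonneg h0 h1 S)
    _ = _ := by
        simp_rw [mul_sub, Finset.sum_sub_distrib, mul_one]
        rw [sum_familyProb, Finset.mul_sum]
        congr 1
        exact Finset.sum_congr rfl fun S _ => by ring

end TensorReconstruction

namespace TensorReconstruction

open Finset

/-! ### Asymptotics -/

/-- The geometric sum 1 + q + ... + q^t has t + 1 terms, each at least q^t. -/
theorem add_one_mul_pow_mul_le {q : ℝ} (h0 : 0 ≤ q) (h1 : q ≤ 1) (t : ℕ) :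
    (t + 1) * q ^ t * (1 - q) ≤ 1 := by
  have h : (t + 1) * q ^ t * (1 - q) ≤ 1 - q ^ (t + 1) := by
    induction t with
    | zero => simp
    | succ t ih =>
      have h2 : q ^ (t + 1) ≤ 1 := pow_le_one₀ h0 h1
      have h3 := mul_le_mul_of_nonneg_left ih h0
      have h4 := mul_le_mul_of_nonneg_right h2 (sub_nonneg.2 h1)
      push_cast
      calc ((t : ℝ) + 1 + 1) * q ^ (t + 1) * (1 - q) =
          q * ((t + 1) * q ^ t * (1 - q)) + q ^ (t + 1) * (1 - q) := by ring
        _ ≤ q * (1 - q ^ (t + 1)) + 1 * (1 - q) := add_le_add h3 h4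
        _ = 1 - q ^ (t + 1 + 1) := by ring
  have : 0 ≤ q ^ (t + 1) := pow_nonneg h0 _
  linarith

/-- Below the threshold, the number of unseen entries has almost pairwise independent terms. -/
theorem unseen_pair_le {k N m s : ℕ} {p p₀ : ℝ} (hk : 1 ≤ k) (hN : 1 ≤ N) (hp₀ : 0 < p₀)
    (hp : p₀ ≤ p) (hp1 : p < 1) (hs : s ≤ k)
    (hm : (m : ℝ) * (1 - p) ^ k ≤ p₀ ^ 3 / 2 * (k * Real.log N)) :
    (1 - 2 * (1 - p) ^ k + (1 - p) ^ (2 * k - s)) ^ m ≤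
      ((1 - (1 - p) ^ k) ^ m) ^ 2 * √N ^ s := by
  set q := 1 - p with hq
  have hq0 : 0 < q := by linarith
  have hq1 : q ≤ 1 := by linarith
  have hN' : (0 : ℝ) < N := by exact_mod_cast hN
  have hlog : 0 ≤ Real.log N := Real.log_nonneg (by exact_mod_cast hN)
  rw [← pow_mul, mul_comm m 2, pow_mul]
  -- For s = 0 the two events are exactly independent.
  rcases Nat.eq_zero_or_pos s with rfl | hs0
  · rw [pow_zero, mul_one]
    refine le_of_eq ?_
    congr 1
    rw [Nat.sub_zero, mul_comm 2 k, pow_mul]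
    ring
  have hqk : q ^ k ≤ q := by
    simpa using pow_le_pow_of_le_one hq0.le hq1 hk
  have ha : p₀ ≤ 1 - q ^ k := by linarith
  have h2k : q ^ (2 * k) = q ^ k * q ^ k := by rw [← pow_add]; congr 1; omega
  have hmono : q ^ (2 * k) ≤ q ^ (2 * k - s) := pow_le_pow_of_le_one hq0.le hq1 (Nat.sub_le _ _)
  -- The left side is at most (1 - q^k)² + q^(2k-s), and (1 - q^k)² ≥ p₀². This costs two of the
  -- three factors p₀ in the threshold.
  have hb : 1 - 2 * q ^ k + q ^ (2 * k - s) ≤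
      (1 - q ^ k) ^ 2 * Real.exp (q ^ (2 * k - s) / p₀ ^ 2) := by
    have e1 := Real.add_one_le_exp (q ^ (2 * k - s) / p₀ ^ 2)
    have e2 : p₀ ^ 2 ≤ (1 - q ^ k) ^ 2 := pow_le_pow_left₀ hp₀.le ha 2
    have e3 : q ^ (2 * k - s) ≤ (1 - q ^ k) ^ 2 * (q ^ (2 * k - s) / p₀ ^ 2) := by
      rw [mul_div_assoc', le_div_iff₀ (by positivity), mul_comm]
      exact mul_le_mul_of_nonneg_right e2 (by positivity)
    have e4 := mul_le_mul_of_nonneg_left e1 (sq_nonneg (1 - q ^ k))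
    have e5 : 0 ≤ q ^ k * q ^ k := by positivity
    nlinarith
  have hb0 : 0 ≤ 1 - 2 * q ^ k + q ^ (2 * k - s) := by
    have := sq_nonneg (1 - q ^ k)
    nlinarith
  calc _ ≤ ((1 - q ^ k) ^ 2 * Real.exp (q ^ (2 * k - s) / p₀ ^ 2)) ^ m :=
        pow_le_pow_left₀ hb0 hb m
    _ = ((1 - q ^ k) ^ 2) ^ m * Real.exp (m * (q ^ (2 * k - s) / p₀ ^ 2)) := by
        rw [mul_pow, ← Real.exp_nat_mul]
    _ ≤ ((1 - q ^ k) ^ 2) ^ m * √N ^ s := by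
        refine mul_le_mul_of_nonneg_left ?_ (by positivity)
        have hsq : √(N : ℝ) ^ s = Real.exp (s * (Real.log N / 2)) := by
          rw [← Real.log_sqrt hN'.le, Real.exp_nat_mul, Real.exp_log (Real.sqrt_pos.2 hN')]
        rw [hsq, Real.exp_le_exp, mul_div_assoc', div_le_iff₀ (by positivity)]
        have e1 : q ^ (2 * k - s) = q ^ k * q ^ (k - s) := by rw [← pow_add]; congr 1; omega
        -- For s ≥ 1 one has k ≤ s(k - s + 1). The third factor p₀ is spent on p₀ ≤ 1 - q, which
        -- keeps the constant independent of k.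
        have e2 : (k : ℝ) * q ^ (k - s) * p₀ ≤ s := by
          have f1 := add_one_mul_pow_mul_le hq0.le hq1 (k - s)
          have f2 : (k : ℝ) ≤ s * ((k - s : ℕ) + 1) := by
            have : k ≤ s * ((k - s) + 1) := by
              obtain ⟨t, rfl⟩ := Nat.exists_eq_add_of_le hs
              rw [Nat.add_sub_cancel_left]
              nlinarith
            exact_mod_cast this
          have f3 : p₀ ≤ 1 - q := by linarith
          calc (k : ℝ) * q ^ (k - s) * p₀ ≤ (s * ((k - s : ℕ) + 1)) * q ^ (k - s) * (1 - q) := by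
                gcongr
            _ = s * (((k - s : ℕ) + 1) * q ^ (k - s) * (1 - q)) := by ring
            _ ≤ s * 1 := mul_le_mul_of_nonneg_left f1 (Nat.cast_nonneg s)
            _ = s := mul_one _
        calc (m : ℝ) * q ^ (2 * k - s) = (m * q ^ k) * q ^ (k - s) := by rw [e1]; ring
          _ ≤ p₀ ^ 3 / 2 * (k * Real.log N) * q ^ (k - s) := by gcongr
          _ = p₀ ^ 2 * (Real.log N / 2) * (k * q ^ (k - s) * p₀) := by ring
          _ ≤ p₀ ^ 2 * (Real.log N / 2) * s := by gcongr
          _ = s * (Real.log N / 2) * p₀ ^ 2 := by ring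

theorem successProb_le_one {k N m : ℕ} {p : ℝ} (h0 : 0 ≤ p) (h1 : p ≤ 1)
    (est : Estimator k N m) : successProb p est ≤ 1 := by
  classical
  have h := successProb_le_of_unseen h0 h1 est
  have : 0 ≤ ∑ S : Fin m → Pattern k N,
      familyProb p S * (if ∃ e, Unseen S e then (1 : ℝ) else 0) :=
    Finset.sum_nonneg fun S _ => mul_nonneg (familyProb_nonneg h0 h1 S) (by split_ifs <;> norm_num)
  refine h.trans ?_
  linarith

/-- Below the threshold, every estimator fails with constant probability. -/
theorem successProb_le_of_lt {k N m : ℕ} {p p₀ : ℝ} (hk : 1 ≤ k) (hN : 1 ≤ N) (hp₀ : 0 < p₀)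
    (hp : p₀ ≤ p) (hp1 : p < 1) (hN2 : (1 + (√(N : ℝ))⁻¹) ^ k ≤ 2)
    (hm : (m : ℝ) * (1 - p) ^ k ≤ p₀ ^ 3 / 2 * (k * Real.log N)) (est : Estimator k N m) :
    successProb p est ≤ 3 / 4 := by
  classical
  have hN' : (0 : ℝ) < N := by exact_mod_cast hN
  have h0 : 0 ≤ p := by linarith
  refine (successProb_le_of_unseen h0 hp1.le est).trans ?_
  -- With y = √N, the second moment sum is at most N^(2k) (1 + 1/√N)^k, hence at most twice N^(2k).
  have h := sq_le_mul_sum_familyProb_exists_unseen (k := k) (N := N) (m := m) (y := √N) h0 hp1.le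
    fun e e' => unseen_pair_le hk hN hp₀ hp hp1
      ((Finset.card_le_univ _).trans (by simp)) hm
  set R := ∑ S : Fin m → Pattern k N, familyProb p S * (if ∃ e, Unseen S e then (1 : ℝ) else 0)
    with hR
  have hR0 : 0 ≤ R :=
    Finset.sum_nonneg fun S _ => mul_nonneg (familyProb_nonneg h0 hp1.le S)
      (by split_ifs <;> norm_num)
  have ha : 0 < 1 - (1 - p) ^ k := by
    have : (1 - p) ^ k < 1 := pow_lt_one₀ (by linarith) (by linarith) (by omega)
    linarith
  have hA : 0 < ((1 - (1 - p) ^ k) ^ m) ^ 2 := by positivity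
  rw [mul_pow, mul_comm, mul_assoc, mul_le_mul_iff_right₀ hA] at h
  have hsq : 0 < √(N : ℝ) := Real.sqrt_pos.2 hN'
  have h2 : ((N : ℝ) * (√N - 1) + N ^ 2) ^ k ≤ (N ^ k) ^ 2 * 2 := by
    calc ((N : ℝ) * (√N - 1) + N ^ 2) ^ k ≤ (N ^ 2 * (1 + (√(N : ℝ))⁻¹)) ^ k := by
          refine pow_le_pow_left₀ ?_ ?_ k
          · have : (1 : ℝ) ≤ N := by exact_mod_cast hN
            nlinarith
          · have : (N : ℝ) ^ 2 * (√(N : ℝ))⁻¹ = N * √N := by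
              rw [← div_eq_mul_inv, div_eq_iff hsq.ne', mul_assoc, Real.mul_self_sqrt hN'.le, pow_two]
            rw [mul_add, this]
            linarith
      _ = (N ^ k) ^ 2 * (1 + (√(N : ℝ))⁻¹) ^ k := by rw [mul_pow, ← pow_mul, ← pow_mul, mul_comm 2 k]
      _ ≤ _ := by gcongr
  have h3 := h.trans (mul_le_mul_of_nonneg_right h2 hR0)
  have hB : 0 < ((N : ℝ) ^ k) ^ 2 := by positivity
  have h4 : 1 ≤ 2 * R := by
    by_contra hcon
    push Not at hcon
    nlinarith
  linarith

theorem eventually_le_of_reconstructsWHP {k : ℕ} {p p₀ : ℝ} (hk : 1 ≤ k) (hp₀ : 0 < p₀)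
    (hp : p₀ ≤ p) (hp1 : p < 1) (m : ℕ → ℕ) (est : (N : ℕ) → Estimator k N (m N))
    (h : ReconstructsWHP p m est) :
    ∀ᶠ N : ℕ in atTop,
      p₀ ^ 3 / 2 * (Real.log ((N : ℝ) ^ k) / (1 - p) ^ k) ≤ (m N : ℝ) := by
  have h1 : ∀ᶠ N : ℕ in atTop, 3 / 4 < successProb p (est N) :=
    h.eventually_const_lt (by norm_num)
  have h2 : Tendsto (fun N : ℕ => (1 + (√(N : ℝ))⁻¹) ^ k) atTop (𝓝 ((1 + 0) ^ k)) :=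
    ((tendsto_inv_atTop_zero.comp
      (Real.tendsto_sqrt_atTop.comp tendsto_natCast_atTop_atTop)).const_add 1).pow k
  rw [add_zero, one_pow] at h2
  filter_upwards [h1, h2.eventually_le_const (by norm_num : (1 : ℝ) < 2), eventually_ge_atTop 1]
    with N e1 e2 e3
  by_contra hcon
  push Not at hcon
  have hq : 0 < (1 - p) ^ k := pow_pos (by linarith) k
  rw [mul_div_assoc', lt_div_iff₀ hq, Real.log_pow] at hcon
  exact absurd (successProb_le_of_lt hk e3 hp₀ hp hp1 e2 hcon.le (est N)) (not_le.2 e1)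

/-! ### Vanishing of the error terms in the upper bound -/

theorem one_sub_pow_le_exp {x : ℝ} (hx : x ≤ 1) (n : ℕ) : (1 - x) ^ n ≤ Real.exp (-(n * x)) := by
  have h := Real.add_one_le_exp (-x)
  calc (1 - x) ^ n ≤ Real.exp (-x) ^ n := pow_le_pow_left₀ (by linarith) (by linarith) n
    _ = Real.exp (-(n * x)) := by rw [← Real.exp_nat_mul]; congr 1; ring

/-- The number of traces that suffices. -/
noncomputable def numTraces (k : ℕ) (p : ℝ) (N : ℕ) : ℕ := ⌈2 * (Real.log ((N : ℝ) ^ k) / (1 - p) ^ k)⌉₊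

/-- A crude bound suffices: the number of pairs of traces only has to be beaten by terms
exponentially small in N. -/
theorem eventually_numTraces_le (k : ℕ) (p : ℝ) : ∀ᶠ N : ℕ in atTop, numTraces k p N ≤ N := by
  set A : ℝ := |2 * (k / (1 - p) ^ k)| + 1 with hA
  have hA0 : 0 < A := by positivity
  have h := (Real.isLittleO_log_id_atTop.comp_tendsto tendsto_natCast_atTop_atTop).bound
    (by positivity : 0 < A⁻¹)
  filter_upwards [h, eventually_ge_atTop 1] with N hN hN1
  have hlog : 0 ≤ Real.log N := Real.log_nonneg (by exact_mod_cast hN1)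
  simp only [Function.comp_apply, id, Real.norm_eq_abs, abs_of_nonneg hlog, Nat.abs_cast] at hN
  rw [inv_mul_eq_div, le_div_iff₀ hA0] at hN
  refine Nat.ceil_le.2 ?_
  rw [Real.log_pow]
  calc 2 * (k * Real.log N / (1 - p) ^ k) = Real.log N * (2 * (k / (1 - p) ^ k)) := by ring
    _ ≤ Real.log N * A := by
        refine mul_le_mul_of_nonneg_left ?_ hlog
        have := le_abs_self (2 * (k / (1 - p) ^ k))
        linarith
    _ ≤ N := hN

/-- The constant 2 makes the miss probability at most n⁻², against k^k n lists of cells. -/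
theorem tendsto_uncovered {k : ℕ} {p : ℝ} (hk : 1 ≤ k) (h0 : 0 ≤ p) (h1 : p < 1) :
    Tendsto (fun N : ℕ => ((k : ℝ) * N) ^ k * (1 - (1 - p) ^ k) ^ numTraces k p N) atTop (𝓝 0) := by
  have hq : 0 < (1 - p) ^ k := pow_pos (by linarith) k
  have hq1 : (1 - p) ^ k ≤ 1 := pow_le_one₀ (by linarith) (by linarith)
  have hlim : Tendsto (fun N : ℕ => (k : ℝ) ^ k / N) atTop (𝓝 0) :=
    tendsto_const_div_atTop_nhds_zero_nat _
  refine squeeze_zero' (Eventually.of_forall fun N => ?_) ?_ hlim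
  · have : 0 ≤ 1 - (1 - p) ^ k := by linarith
    positivity
  filter_upwards [eventually_ge_atTop 1] with N hN
  have hN1 : (1 : ℝ) ≤ N := by exact_mod_cast hN
  have hN0 : (0 : ℝ) < N := by linarith
  have e1 : 2 * Real.log ((N : ℝ) ^ k) ≤ numTraces k p N * (1 - p) ^ k := by
    have := Nat.le_ceil (2 * (Real.log ((N : ℝ) ^ k) / (1 - p) ^ k))
    rw [mul_div_assoc', div_le_iff₀ hq] at this
    rwa [numTraces, mul_div_assoc']
  have e2 : (1 - (1 - p) ^ k) ^ numTraces k p N ≤ ((N : ℝ) ^ k * N ^ k)⁻¹ := by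
    refine (one_sub_pow_le_exp hq1 _).trans ?_
    rw [Real.exp_neg]
    refine inv_anti₀ (by positivity) ?_
    rw [← Real.exp_log (by positivity : (0 : ℝ) < N ^ k * N ^ k), Real.exp_le_exp,
      Real.log_mul (by positivity) (by positivity)]
    linarith
  calc _ ≤ ((k : ℝ) * N) ^ k * ((N : ℝ) ^ k * N ^ k)⁻¹ := by gcongr
    _ = (k : ℝ) ^ k / N ^ k := by rw [mul_pow]; field_simp
    _ ≤ (k : ℝ) ^ k / N := by
        gcongr
        exact le_self_pow₀ hN1 (by omega)

/-- The lower bound on the overlap of two traces. -/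
noncomputable def minOverlap (p : ℝ) (N : ℕ) : ℕ := ⌊(1 - p) ^ 2 * N / 4⌋₊

theorem tendsto_const_mul_pow_mul_exp {c : ℝ} (hc : 0 < c) (a : ℝ) (j : ℕ) :
    Tendsto (fun N : ℕ => a * ((N : ℝ) ^ j * Real.exp (-c) ^ N)) atTop (𝓝 0) := by
  have h := (tendsto_pow_const_mul_const_pow_of_abs_lt_one j (r := Real.exp (-c)) (by
    rw [abs_of_pos (Real.exp_pos _), Real.exp_lt_one_iff]
    linarith)).const_mul a
  rwa [mul_zero] at h

/-- The factor 2^l costs at most exp(q²N/4), against a gain of exp(-q²N/2). -/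
theorem tendsto_small_overlap {k : ℕ} {p : ℝ} (h0 : 0 ≤ p) (h1 : p < 1) :
    Tendsto (fun N : ℕ => (numTraces k p N : ℝ) ^ 2 *
      (k * (2 ^ minOverlap p N * (1 - (1 - p) ^ 2 / 2) ^ N))) atTop (𝓝 0) := by
  have hq : 0 < (1 - p) ^ 2 := pow_pos (by linarith) 2
  have hq1 : (1 - p) ^ 2 ≤ 1 := pow_le_one₀ (by linarith) (by linarith)
  have hq2 : 0 ≤ 1 - (1 - p) ^ 2 / 2 := by linarith
  have hlim := tendsto_const_mul_pow_mul_exp (c := (1 - p) ^ 2 / 4) (by positivity) k 2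
  refine squeeze_zero' (Eventually.of_forall fun N => by positivity) ?_ hlim
  filter_upwards [eventually_numTraces_le k p] with N hN
  have e1 : (2 : ℝ) ^ minOverlap p N ≤ Real.exp ((1 - p) ^ 2 * N / 4) := by
    have f1 : (minOverlap p N : ℝ) ≤ (1 - p) ^ 2 * N / 4 := Nat.floor_le (by positivity)
    calc (2 : ℝ) ^ minOverlap p N ≤ Real.exp 1 ^ minOverlap p N := by
          gcongr
          have := Real.add_one_le_exp 1
          linarith
      _ = Real.exp (minOverlap p N) := by rw [← Real.exp_nat_mul, mul_one]
      _ ≤ _ := Real.exp_le_exp.2 f1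
  have e2 := one_sub_pow_le_exp (x := (1 - p) ^ 2 / 2) (by linarith) N
  calc _ ≤ (N : ℝ) ^ 2 * (k * (Real.exp ((1 - p) ^ 2 * N / 4) *
        Real.exp (-(N * ((1 - p) ^ 2 / 2))))) := by
        gcongr
    _ = _ := by
        rw [← Real.exp_add, ← Real.exp_nat_mul]
        have : (1 - p) ^ 2 * N / 4 + -(N * ((1 - p) ^ 2 / 2)) = N * -((1 - p) ^ 2 / 4) := by ring
        rw [this]
        ring

/-- The constant 32 is 4 (overlap) times 4 (division by 4k) times 2 (from 1/2 ≤ exp(-1/2)); the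
factor e absorbs both roundings. -/
theorem half_pow_minOverlap_le {k : ℕ} (hk : 1 ≤ k) (p : ℝ) (N : ℕ) :
    (1 / 2 : ℝ) ^ (minOverlap p N / (4 * k)) ≤
      Real.exp 1 * Real.exp (-((1 - p) ^ 2 / (32 * k))) ^ N := by
  have hk0 : (0 : ℝ) < k := by exact_mod_cast hk
  have hk1 : (1 : ℝ) ≤ k := by exact_mod_cast hk
  set n := minOverlap p N / (4 * k) with hn
  have e1 : (1 - p) ^ 2 * N / 4 < minOverlap p N + 1 := Nat.lt_floor_add_one _
  have e2 : (minOverlap p N : ℝ) ≤ 4 * k * (n + 1) := by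
    have := (Nat.lt_mul_div_succ (minOverlap p N) (by omega : 0 < 4 * k)).le
    exact_mod_cast this
  have e3 : (1 - p) ^ 2 / (32 * k) * N ≤ n / 2 + 1 := by
    rw [div_mul_eq_mul_div, div_le_iff₀ (by positivity)]
    nlinarith
  have e4 : (1 / 2 : ℝ) ≤ Real.exp (-(1 / 2)) := by
    have := Real.add_one_le_exp (-(1 / 2 : ℝ))
    linarith
  calc (1 / 2 : ℝ) ^ n ≤ Real.exp (-(1 / 2)) ^ n := by gcongr
    _ = Real.exp (-(n / 2)) := by rw [← Real.exp_nat_mul]; congr 1; ring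
    _ ≤ Real.exp (1 + N * -((1 - p) ^ 2 / (32 * k))) := Real.exp_le_exp.2 (by linarith)
    _ = _ := by rw [Real.exp_add, Real.exp_nat_mul]

theorem tendsto_bad_matching {k : ℕ} {p : ℝ} (hk : 1 ≤ k) (h1 : p < 1) :
    Tendsto (fun N : ℕ => (numTraces k p N : ℝ) ^ 2 *
      ((1 + (1 / 2) ^ (minOverlap p N / (4 * k))) ^ (k * N ^ 2) - 1)) atTop (𝓝 0) := by
  have hk0 : (0 : ℝ) < k := by exact_mod_cast hk
  have hq : 0 < 1 - p := by linarith
  have hc : 0 < (1 - p) ^ 2 / (32 * k) := by positivity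
  have hlim := tendsto_const_mul_pow_mul_exp hc (2 * k * Real.exp 1) 4
  have hsmall := tendsto_const_mul_pow_mul_exp hc (k * Real.exp 1) 2
  refine squeeze_zero' (Eventually.of_forall fun N => ?_) ?_ hlim
  · refine mul_nonneg (by positivity) (sub_nonneg.2 (one_le_pow₀ ?_))
    have : (0 : ℝ) ≤ (1 / 2) ^ (minOverlap p N / (4 * k)) := by positivity
    linarith
  filter_upwards [eventually_numTraces_le k p, hsmall.eventually_le_const one_pos] with N hN hN1
  have hx := half_pow_minOverlap_le hk p N
  set x : ℝ := (1 / 2) ^ (minOverlap p N / (4 * k)) with hxdef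
  have hx0 : 0 ≤ x := by positivity
  set ρ := Real.exp (-((1 - p) ^ 2 / (32 * k))) ^ N with hρ
  have e1 : k * N ^ 2 * x ≤ k * Real.exp 1 * (N ^ 2 * ρ) := by
    calc k * N ^ 2 * x ≤ k * N ^ 2 * (Real.exp 1 * ρ) := by gcongr
      _ = _ := by ring
  -- Uses exp z - 1 ≤ 2z for 0 ≤ z ≤ 1; the argument is eventually at most 1.
  have e2 : (1 + x) ^ (k * N ^ 2) - 1 ≤ 2 * (k * N ^ 2 * x) := by
    have f1 : (1 + x) ^ (k * N ^ 2) ≤ Real.exp (k * N ^ 2 * x) := by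
      have := Real.add_one_le_exp x
      calc (1 + x) ^ (k * N ^ 2) ≤ Real.exp x ^ (k * N ^ 2) :=
            pow_le_pow_left₀ (by linarith) (by linarith) _
        _ = Real.exp (k * N ^ 2 * x) := by rw [← Real.exp_nat_mul]; push_cast; rfl
    have f0 : 0 ≤ k * N ^ 2 * x := by positivity
    have f2 := Real.abs_exp_sub_one_le (x := k * N ^ 2 * x) (by
      rw [abs_of_nonneg f0]; exact e1.trans hN1)
    rw [abs_of_nonneg f0] at f2
    have := le_abs_self (Real.exp (k * N ^ 2 * x) - 1)
    linarith
  calc _ ≤ (N : ℝ) ^ 2 * (2 * (k * Real.exp 1 * (N ^ 2 * ρ))) := by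
        have : (numTraces k p N : ℝ) ≤ N := by exact_mod_cast hN
        have h3 : 0 ≤ 2 * (k * Real.exp 1 * (N ^ 2 * ρ)) := by positivity
        exact (mul_le_mul_of_nonneg_left (e2.trans (by linarith)) (by positivity)).trans
          (mul_le_mul_of_nonneg_right (by gcongr) h3)
    _ = _ := by ring

theorem exists_reconstructsWHP {k : ℕ} {p : ℝ} (hk : 2 ≤ k) (h0 : 0 ≤ p) (h1 : p < 1) (m : ℕ → ℕ)
    (hm : ∀ᶠ N : ℕ in atTop, 2 * (Real.log ((N : ℝ) ^ k) / (1 - p) ^ k) ≤ (m N : ℝ)) :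
    ∃ est : (N : ℕ) → Estimator k N (m N), ReconstructsWHP p m est := by
  -- Surplus traces are ignored: `m` may be arbitrarily large, while the error terms grow with the
  -- number of pairs of traces used.
  have hJ : ∀ N, ∃ J : Finset (Fin (m N)), J.card = min (m N) (numTraces k p N) := by
    intro N
    obtain ⟨J, -, hJ⟩ := Finset.exists_subset_card_eq (s := (univ : Finset (Fin (m N))))
      (n := min (m N) (numTraces k p N)) (by simp)
    exact ⟨J, hJ⟩
  choose J hJ using hJ
  choose est hest using fun N =>
    exists_estimator_le_successProb (N := N) hk h0 h1.le (J N) (minOverlap p N)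
  refine ⟨est, ?_⟩
  have hlim := (((tendsto_uncovered (k := k) (by omega) h0 h1).add (tendsto_small_overlap (k := k) h0 h1)).add
    (tendsto_bad_matching (k := k) (by omega) h1)).const_sub 1
  simp only [add_zero, sub_zero] at hlim
  refine tendsto_of_tendsto_of_tendsto_of_le_of_le' hlim tendsto_const_nhds ?_
    (Eventually.of_forall fun N => successProb_le_one h0 h1.le _)
  filter_upwards [hm] with N hN
  have hle : numTraces k p N ≤ m N := Nat.ceil_le.2 hN
  have := hest N
  rwa [hJ, min_eq_right hle] at this

end TensorReconstruction

theorem mainTheorem11 :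
    (∃ C : ℝ, 0 < C ∧ ∀ k : ℕ, 2 ≤ k → ∀ p : ℝ, 0 ≤ p → p < 1 →
      ∀ m : ℕ → ℕ, (∀ᶠ N : ℕ in atTop, C * (Real.log ((N : ℝ) ^ k) / (1 - p) ^ k) ≤ (m N : ℝ)) →
        ∃ est : (N : ℕ) → TensorReconstruction.Estimator k N (m N),
          TensorReconstruction.ReconstructsWHP p m est) ∧
    (∀ p₀ : ℝ, 0 < p₀ → ∃ c : ℝ, 0 < c ∧ ∀ k : ℕ, 2 ≤ k → ∀ p : ℝ, p₀ ≤ p → p < 1 →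
      ∀ (m : ℕ → ℕ) (est : (N : ℕ) → TensorReconstruction.Estimator k N (m N)),
        TensorReconstruction.ReconstructsWHP p m est →
          ∀ᶠ N : ℕ in atTop, c * (Real.log ((N : ℝ) ^ k) / (1 - p) ^ k) ≤ (m N : ℝ)) := by
  refine ⟨⟨2, two_pos, fun k hk p h0 h1 m hm =>
    TensorReconstruction.exists_reconstructsWHP hk h0 h1 m hm⟩, fun p₀ hp₀ =>
    ⟨p₀ ^ 3 / 2, by positivity, fun k hk p hp h1 m est h =>
      TensorReconstruction.eventually_le_of_reconstructsWHP (by omega) hp₀ hp h1 m est h⟩⟩
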